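/- Let $\mathfrak g_{5,37}$ be the real Lie algebra with basis $e_1,\dots,e_5$ and the nonzero brackets $$[e_1,e_4]=2e_1,\quad [e_2,e_3]=e_1,\quad [e_2,e_4]=e_2,\quad [e_2,e_5]=-e_3,\quad [e_3,e_4]=e_3,\quad [e_3,e_5]=e_2$$ (up to antisymmetry). A holomorphic realization of $\mathfrak g_{5,37}$ on an open set $U\subset\mathbb C^3$ (coordinates $z_1,z_2,w=u+iv$) is a faithful representation of $\mathfrak g_{5,37}$, as a real Lie algebra, by holomorphic vector fields $X=f\,\partial/\partial z_1+g\,\partial/\partial z_2+h\,\partial/\partial w$ on $U$. A $5$-dimensional orbit of it is a connected real-analytic real hypersurface $M\subset U$ (embedded, not necessarily closed) such that at every $p\in M$ the values at $p$ of the real vector fields $2\,\mathrm{Re}\,X$, for $X$ in the realization, form exactly the tangent space $T_pM$. Then every $5$-dimensional orbit $M$ of every holomorphic realization of $\mathfrak g_{5,37}$ whose Levi form is nondegenerate at each point is spherical: for one of the two quadrics $$Q_\pm=\{\,v=|z_1|^2\pm|z_2|^2\,\},$$ every point $p\in M$ has an open neighbourhood $V\subset\mathbb C^3$ and a biholomorphic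 map $F$ of $V$ onto an open set $W\subset\mathbb C^3$ with $F(M\cap V)=Q\cap W$, where $Q$ is that quadric. -/

import Mathlib

open Topology

noncomputable section

/-- The five-dimensional real Lie algebra `𝔤_{5,37}`; the vector `x` stands for
`x 0 • e₁ + x 1 • e₂ + x 2 • e₃ + x 3 • e₄ + x 4 • e₅`. -/
def G537 : Type := Fin 5 → ℝ

namespace G537

instance : AddCommGroup G537 := inferInstanceAs (AddCommGroup (Fin 5 → ℝ))

instance : Module ℝ G537 := inferInstanceAs (Module ℝ (Fin 5 → ℝ))

/-- The bilinear extension of the relations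
`[e₁,e₄] = 2e₁`, `[e₂,e₃] = e₁`, `[e₂,e₄] = e₂`, `[e₂,e₅] = -e₃`, `[e₃,e₄] = e₃`,
`[e₃,e₅] = e₂`; the other brackets `[e_i,e_j]`, `i < j`, are zero. -/
instance : Bracket G537 G537 where
  bracket x y :=
    ![2 * (x 0 * y 3 - x 3 * y 0) + (x 1 * y 2 - x 2 * y 1),
      (x 1 * y 3 - x 3 * y 1) + (x 2 * y 4 - x 4 * y 2),
      (x 2 * y 3 - x 3 * y 2) - (x 1 * y 4 - x 4 * y 1),
      0,
      0]

theorem ext_coords {x y : G537} (h0 : x 0 = y 0) (h1 : x 1 = y 1) (h2 : x 2 = y 2)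
    (h3 : x 3 = y 3) (h4 : x 4 = y 4) : x = y := by
  funext i
  fin_cases i
  exacts [h0, h1, h2, h3, h4]

theorem add_apply (x y : G537) (i : Fin 5) : (x + y) i = x i + y i := rfl

theorem smul_apply (t : ℝ) (x : G537) (i : Fin 5) : (t • x) i = t * x i := rfl

theorem zero_apply (i : Fin 5) : (0 : G537) i = 0 := rfl

theorem lie_apply_zero (x y : G537) :
    ⁅x, y⁆ 0 = 2 * (x 0 * y 3 - x 3 * y 0) + (x 1 * y 2 - x 2 * y 1) := rfl

theorem lie_apply_one (x y : G537) :
    ⁅x, y⁆ 1 = (x 1 * y 3 - x 3 * y 1) + (x 2 * y 4 - x 4 * y 2) := rfl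

theorem lie_apply_two (x y : G537) :
    ⁅x, y⁆ 2 = (x 2 * y 3 - x 3 * y 2) - (x 1 * y 4 - x 4 * y 1) := rfl

theorem lie_apply_three (x y : G537) : ⁅x, y⁆ 3 = 0 := rfl

theorem lie_apply_four (x y : G537) : ⁅x, y⁆ 4 = 0 := rfl

instance : LieRing G537 where
  add_lie x y z := by
    apply ext_coords <;> simp only [add_apply, lie_apply_zero, lie_apply_one, lie_apply_two,
      lie_apply_three, lie_apply_four] <;> ring
  lie_add x y z := by
    apply ext_coords <;> simp only [add_apply, lie_apply_zero, lie_apply_one, lie_apply_two,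
      lie_apply_three, lie_apply_four] <;> ring
  lie_self x := by
    apply ext_coords <;> simp only [zero_apply, lie_apply_zero, lie_apply_one, lie_apply_two,
      lie_apply_three, lie_apply_four] <;> ring
  leibniz_lie x y z := by
    apply ext_coords <;> simp only [add_apply, lie_apply_zero, lie_apply_one, lie_apply_two,
      lie_apply_three, lie_apply_four] <;> ring

instance : LieAlgebra ℝ G537 where
  lie_smul t x y := by
    apply ext_coords <;> simp only [smul_apply, lie_apply_zero, lie_apply_one, lie_apply_two,
      lie_apply_three, lie_apply_four] <;> ring

end G537

/-- The space `ℂ³`; the coordinates `(z₁, z₂, w)` of `z` are `(z 0, z 1, z 2)`. -/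
abbrev C3 : Type := Fin 3 → ℂ

/-- A holomorphic realization of `𝔤_{5,37}` on an open set `U ⊆ ℂ³`: a faithful representation
by holomorphic vector fields on `U`. The vector field `f ∂/∂z₁ + g ∂/∂z₂ + h ∂/∂w` is given by
its coefficient map `(f, g, h)`; only the values on `U` matter. -/
structure IsHolomorphicRealization (U : Set C3) (ρ : G537 →ₗ[ℝ] (C3 → C3)) : Prop where
  isOpen : IsOpen U
  holomorphic : ∀ x, DifferentiableOn ℂ (ρ x) U
  map_lie : ∀ x y, ∀ z ∈ U, ρ ⁅x, y⁆ z = VectorField.lieBracket ℂ (ρ x) (ρ y) z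
  faithful : ∀ x, (∀ z ∈ U, ρ x z = 0) → x = 0

/-- `Φ` is a real-analytic defining function of `M` near the point `p ∈ M`. -/
structure IsDefiningFunctionAt (M : Set C3) (p : C3) (Φ : C3 → ℝ) : Prop where
  analyticAt : AnalyticAt ℝ Φ p
  fderiv_ne_zero : fderiv ℝ Φ p ≠ 0
  mem_iff : ∀ᶠ q in 𝓝 p, q ∈ M ↔ Φ q = 0

/-- An (embedded, not necessarily closed) real-analytic hypersurface in `ℂ³`. -/
def IsRealAnalyticHypersurface (M : Set C3) : Prop :=
  ∀ p ∈ M, ∃ Φ, IsDefiningFunctionAt M p Φ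

/-- The values at `p` of the vector fields of a realization, as an `ℝ`-linear map. A field `X`
corresponds to the real vector field `2 Re X`, whose value at `p` is the vector `X p` of
`ℂ³ = ℝ⁶`. -/
def evalAt (ρ : G537 →ₗ[ℝ] (C3 → C3)) (p : C3) : G537 →ₗ[ℝ] C3 :=
  (LinearMap.proj p).comp ρ

/-- A five-dimensional orbit in `U`: a connected real-analytic hypersurface `M ⊆ U` such that at
each of its points the values of the fields fill exactly the real tangent space
`T_p M = ker dΦ(p)`. -/
structure IsFiveDimensionalOrbit (U : Set C3) (ρ : G537 →ₗ[ℝ] (C3 → C3)) (M : Set C3) :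
    Prop where
  subset : M ⊆ U
  isConnected : IsConnected M
  hypersurface : IsRealAnalyticHypersurface M
  range_eq_tangent : ∀ p ∈ M, ∀ Φ, IsDefiningFunctionAt M p Φ →
    LinearMap.range (evalAt ρ p) = LinearMap.ker (fderiv ℝ Φ p : C3 →ₗ[ℝ] ℝ)

/-- The complex tangent space `T_p M ∩ i T_p M` of the hypersurface `Φ = 0`. -/
def complexTangent (Φ : C3 → ℝ) (p : C3) : Set C3 :=
  {ξ | fderiv ℝ Φ p ξ = 0 ∧ fderiv ℝ Φ p (Complex.I • ξ) = 0}

/-- The Levi form `∑ ∂²Φ/∂z_j∂z̄_k (p) ξ_j η̄_k`. Here the (1,0)-derivative along `ξ` is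
`(D_ξ - i D_{iξ})/2`, and the (0,1)-derivative along `η` is `(D_η + i D_{iη})/2`. -/
def leviForm (Φ : C3 → ℝ) (p ξ η : C3) : ℂ :=
  let H : C3 → C3 → ℝ := fun a b => fderiv ℝ (fderiv ℝ Φ) p a b
  (1 / 4 : ℂ) *
    (((H ξ η + H (Complex.I • ξ) (Complex.I • η) : ℝ) : ℂ) +
      Complex.I * ((H ξ (Complex.I • η) - H (Complex.I • ξ) η : ℝ) : ℂ))

/-- At each point of `M` the Levi form is nondegenerate on the complex tangent space (this does
not depend on the defining function). -/
def IsLeviNondegenerate (M : Set C3) : Prop :=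
  ∀ p ∈ M, ∀ Φ, IsDefiningFunctionAt M p Φ →
    ∀ ξ ∈ complexTangent Φ p, (∀ η ∈ complexTangent Φ p, leviForm Φ p ξ η = 0) → ξ = 0

/-- The quadric `v = |z₁|² + ε |z₂|²`, where `v = Im w`. -/
def quadric (ε : ℝ) : Set C3 :=
  {z | (z 2).im = ‖z 0‖ ^ 2 + ε * ‖z 1‖ ^ 2}

/-- `M` is, near each of its points, biholomorphic to an open piece of `Q`: there is a
biholomorphic map `F` from a neighbourhood of `p` onto an open set that takes the part of `M` in
its domain onto the part of `Q` in its range. -/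
def IsLocallyBiholomorphicTo (M Q : Set C3) : Prop :=
  ∀ p ∈ M, ∃ F : OpenPartialHomeomorph C3 C3, p ∈ F.source ∧
    DifferentiableOn ℂ F F.source ∧ DifferentiableOn ℂ F.symm F.target ∧ F.IsImage M Q

/-- A spherical hypersurface: locally biholomorphic to `v = |z₁|² + |z₂|²` or to
`v = |z₁|² - |z₂|²`. -/
def IsSpherical (M : Set C3) : Prop :=
  IsLocallyBiholomorphicTo M (quadric 1) ∨ IsLocallyBiholomorphicTo M (quadric (-1))

end

/-! Near each point of the orbit, coefficient functions of the fields serve as holomorphic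
coordinates in which $M$ becomes $\operatorname{Im}W=\kappa_1|Z_1|^2+\kappa_2|Z_2|^2$. Levi
nondegeneracy forces $\kappa_1\kappa_2\neq0$, and rescaling gives one of the quadrics.

Put $a=e_2+ie_3$, $b=e_2-ie_3$. If $e_1,a,b$ are independent over $\mathbb C$ at $p$, the
coefficients $w,t_1,t_2$ of $e_4$ in this frame are coordinates, since the brackets prescribe all
their derivatives. With $\sigma=t_1-\bar t_2$, the functions $r=\operatorname{Im}w+|t_1|^2-|t_2|^2$
and $|\sigma|^2$ are multiplied by the same factor $2x_3$ under every real combination $x$ of the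
fields. Hence $r/|\sigma|^2$ is constant on $M$, and the mixed term of $|\sigma|^2$ is absorbed into
$W$ (`isBiholomorphicNear_of_free`).

Otherwise, up to the automorphism exchanging $a$ and $b$, the vector $a(p)$ lies in the span of
$e_1(p),b(p)$, which are independent. If $e_4$ is transversal to that span, then $a=z\,e_1$ near
$p$, and the orbit is either $\operatorname{Im}W=|z|^2/4+c|\zeta|^2$ or a level set of
$\operatorname{Im}\tau$ for a holomorphic $\tau$; the latter is Levi-flat, hence excluded
(`isBiholomorphicNear_of_transversal₄`). If only $e_5$ is transversal, the orbit is again Levi-flat.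
If neither is, the real tangent hyperplane would lie in a complex plane, which is impossible for
dimension reasons (`not_mem_plane`).

The sign of the quadric does not depend on the point: the indefinite quadric contains complex lines,
while every holomorphic disc in the definite one is stationary (`not_isBiholomorphicNear_both`), and
$M$ is connected. -/

noncomputable section

/-! ### Complex differentiability implies analyticity in three variables. -/

open MeasureTheory Set in
/-- Integration against a finite measure, as a continuous functional on `C(X, ℂ)`. -/
def ContinuousMap.integralFunctional {X : Type*} [TopologicalSpace X] [CompactSpace X]
    [MeasurableSpace X] [OpensMeasurableSpace X] (μ : Measure X) [IsFiniteMeasure μ] :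
    C(X, ℂ) →L[ℂ] ℂ :=
  LinearMap.mkContinuous
    { toFun := fun φ => ∫ x, φ x ∂μ
      map_add' := fun φ ψ => integral_add
        (φ.continuous.integrable_of_hasCompactSupport (.of_compactSpace _))
        (ψ.continuous.integrable_of_hasCompactSupport (.of_compactSpace _))
      map_smul' := fun c φ => integral_smul c _ }
    (μ.real univ) (fun φ => by
      rw [mul_comm]
      exact norm_integral_le_of_norm_le_const (.of_forall φ.norm_coe_le_norm))

/-- The parameter interval of a circle. -/
abbrev AngleInterval : Type := Set.Icc (0 : ℝ) (2 * Real.pi)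

/-- The parameter space of a three-dimensional torus. -/
abbrev AngleBox : Type := AngleInterval × AngleInterval × AngleInterval

instance : MeasureTheory.MeasureSpace AngleInterval :=
  MeasureTheory.Measure.Subtype.measureSpace

instance : MeasureTheory.IsFiniteMeasure
    (MeasureTheory.volume : MeasureTheory.Measure AngleInterval) :=
  ⟨by
    rw [MeasureTheory.Measure.Subtype.volume_univ measurableSet_Icc.nullMeasurableSet]
    exact measure_Icc_lt_top⟩

open MeasureTheory Set in
/-- The Cauchy integral formula on a disc, the boundary circle being parametrized by
`[0, 2π]`. -/
theorem integral_cauchyKernel_mul {f : ℂ → ℂ} {c w : ℂ} {R : ℝ}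
    (hf : DifferentiableOn ℂ f (Metric.closedBall c R)) (hw : w ∈ Metric.ball c R) :
    ∫ θ : AngleInterval, (2 * Real.pi * Complex.I)⁻¹ * (circleMap 0 R θ * Complex.I) *
      (circleMap c R θ - w)⁻¹ * f (circleMap c R θ) = f w := by
  rw [integral_subtype measurableSet_Icc (fun θ : ℝ => (2 * Real.pi * Complex.I)⁻¹ *
    (circleMap 0 R θ * Complex.I) * (circleMap c R θ - w)⁻¹ * f (circleMap c R θ)),
    integral_Icc_eq_integral_Ioc, ← intervalIntegral.integral_of_le (by positivity)]
  have h := hf.circleIntegral_sub_inv_smul hw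
  simp only [circleIntegral, deriv_circleMap, smul_eq_mul] at h
  have h2 : (2 * Real.pi * Complex.I : ℂ) ≠ 0 := by simp [Real.pi_ne_zero]
  rw [← mul_right_inj' h2, ← h, ← intervalIntegral.integral_const_mul]
  congr 1
  ext θ
  field_simp

open MeasureTheory Set in
/-- A function that is complex differentiable on an open subset of `ℂ³` is analytic there
(Osgood's lemma). -/
theorem DifferentiableOn.analyticAt_C3 {f : C3 → ℂ} {U : Set C3} {p : C3}
    (hf : DifferentiableOn ℂ f U) (hU : U ∈ 𝓝 p) : AnalyticAt ℂ f p := by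
  obtain ⟨R, hR, hRU⟩ := Metric.nhds_basis_closedBall.mem_iff.mp hU
  replace hf := hf.mono hRU
  -- The norm on `C3` is the sup norm, so balls are polydiscs and the Cauchy formula applies in each
  -- variable separately.
  have hm : ∀ c : C3, c ∈ Metric.closedBall p R ↔ (c 0 ∈ Metric.closedBall (p 0) R ∧
      c 1 ∈ Metric.closedBall (p 1) R ∧ c 2 ∈ Metric.closedBall (p 2) R) := by
    intro c
    simp only [Metric.mem_closedBall, dist_pi_le_iff hR.le, Fin.forall_fin_succ]
    simp
  have hmb : ∀ c : C3, c ∈ Metric.ball p R ↔ (c 0 ∈ Metric.ball (p 0) R ∧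
      c 1 ∈ Metric.ball (p 1) R ∧ c 2 ∈ Metric.ball (p 2) R) := by
    intro c
    simp only [Metric.mem_ball, dist_pi_lt_iff hR, Fin.forall_fin_succ]
    simp
  have hγ : ∀ (c : ℂ) (θ : ℝ), circleMap c R θ ∈ Metric.closedBall c R :=
    fun c θ => circleMap_mem_closedBall c hR.le θ
  let γ : AngleBox → C3 := fun θ =>
    ![circleMap (p 0) R (θ.1 : ℝ), circleMap (p 1) R (θ.2.1 : ℝ), circleMap (p 2) R (θ.2.2 : ℝ)]
  have hγm : ∀ θ, γ θ ∈ Metric.closedBall p R := fun θ =>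
    (hm _).2 ⟨hγ _ _, hγ _ _, hγ _ _⟩
  have hγc : Continuous γ := by
    refine continuous_pi fun i => ?_
    fin_cases i
    · exact (continuous_circleMap _ _).comp (by fun_prop)
    · exact (continuous_circleMap _ _).comp (by fun_prop)
    · exact (continuous_circleMap _ _).comp (by fun_prop)
  let m : C(AngleBox, ℂ) :=
    ⟨fun θ => (2 * Real.pi * Complex.I)⁻¹ * (circleMap 0 R (θ.1 : ℝ) * Complex.I) *
      ((2 * Real.pi * Complex.I)⁻¹ * (circleMap 0 R (θ.2.1 : ℝ) * Complex.I)) *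
      ((2 * Real.pi * Complex.I)⁻¹ * (circleMap 0 R (θ.2.2 : ℝ) * Complex.I)), by
      have := continuous_circleMap 0 R
      fun_prop⟩
  let φ : C(AngleBox, ℂ) :=
    ⟨fun θ => f (γ θ), hf.continuousOn.comp_continuous hγc hγm⟩
  -- The denominators of the Cauchy kernel form an affine map from $z$ into the Banach algebra of
  -- continuous functions on the torus. Inversion is analytic on its units, so analyticity in $z$
  -- needs no power series estimate.
  let u : Fin 3 → C3 → C(AngleBox, ℂ) := fun i z =>
    ⟨fun θ => γ θ i, (continuous_apply i).comp hγc⟩ - ContinuousLinearMap.smulRight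
      (ContinuousLinearMap.proj (R := ℂ) (φ := fun _ : Fin 3 => ℂ) i) (1 : C(AngleBox, ℂ)) z
  have hu : ∀ i z θ, u i z θ = γ θ i - z i := by
    intro i z θ
    simp [u]
    rfl
  have hunit : ∀ z ∈ Metric.ball p R, ∀ i, IsUnit (u i z) := by
    intro z hz i
    rw [ContinuousMap.isUnit_iff_forall_ne_zero]
    intro θ h
    rw [hu, sub_eq_zero] at h
    have h1 : Dist.dist (z i) (p i) < R := (dist_pi_lt_iff hR).1 hz i
    rw [← h] at h1
    fin_cases i <;> simp [γ, circleMap, abs_of_pos hR] at h1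
  have hinv : ∀ z ∈ Metric.ball p R, ∀ i θ, Ring.inverse (u i z) θ = (γ θ i - z i)⁻¹ := by
    intro z hz i θ
    have h1 := Ring.mul_inverse_cancel _ (hunit z hz i)
    have h2 := DFunLike.congr_fun h1 θ
    rw [ContinuousMap.mul_apply, hu] at h2
    exact eq_inv_of_mul_eq_one_right h2
  have han : ∀ i, AnalyticAt ℂ (fun z => Ring.inverse (u i z)) p := by
    intro i
    obtain ⟨w, hw⟩ := hunit p (Metric.mem_ball_self hR) i
    have h1 : AnalyticAt ℂ (u i) p := analyticAt_const.sub (ContinuousLinearMap.analyticAt _ p)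
    refine AnalyticAt.fun_comp (f := u i) ?_ h1
    rw [← hw]
    exact analyticAt_inverse w
  have hmain : AnalyticAt ℂ (fun z => ContinuousMap.integralFunctional (volume : Measure (AngleBox))
      (m * Ring.inverse (u 0 z) * Ring.inverse (u 1 z) * Ring.inverse (u 2 z) * φ)) p := by
    refine AnalyticAt.fun_comp (ContinuousLinearMap.analyticAt _ _) ?_
    exact ((((analyticAt_const.mul (han 0)).mul (han 1)).mul (han 2)).mul analyticAt_const)
  refine hmain.congr ?_
  filter_upwards [Metric.ball_mem_nhds p hR] with z hz
  obtain ⟨h0, h1, h2⟩ := (hmb z).1 hz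
  set ψ := m * Ring.inverse (u 0 z) * Ring.inverse (u 1 z) * Ring.inverse (u 2 z) * φ with hψ
  have hψi : ∀ g : C(AngleBox, ℂ), Integrable g (volume : Measure (AngleBox)) := fun g =>
    g.continuous.integrable_of_hasCompactSupport (.of_compactSpace _)
  have hψi2 : ∀ g : C(AngleInterval × AngleInterval, ℂ), Integrable g
      (volume : Measure (AngleInterval × AngleInterval)) := fun g =>
    g.continuous.integrable_of_hasCompactSupport (.of_compactSpace _)
  change ∫ θ, ψ θ ∂(volume : Measure (AngleBox)) = f z
  rw [Measure.volume_eq_prod, integral_prod _ (hψi ψ)]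
  have hz3 : z = ![z 0, z 1, z 2] := by
    ext i; fin_cases i <;> rfl
  have e0 : f z = f ![z 0, z 1, z 2] := by rw [← hz3]
  have hdiff : ∀ g : ℂ → C3, Differentiable ℂ g → ∀ c, MapsTo g (Metric.closedBall c R)
      (Metric.closedBall p R) → DifferentiableOn ℂ (fun t => f (g t)) (Metric.closedBall c R) :=
    fun g hg c hgm => hf.comp hg.differentiableOn hgm
  have hvec : ∀ (i : Fin 3) (a : C3), Differentiable ℂ (fun t : ℂ => Function.update a i t) := by
    intro i a
    rw [differentiable_pi]
    intro j
    by_cases hij : j = i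
    · subst hij; simp
    · simp [hij]
  have hsub := Metric.ball_subset_closedBall (x := p 1) (ε := R)
  have hsub2 := Metric.ball_subset_closedBall (x := p 2) (ε := R)
  rw [e0, ← integral_cauchyKernel_mul (f := fun t => f ![t, z 1, z 2]) (c := p 0) (R := R) ?_ h0]
  · refine integral_congr_ae (.of_forall fun θ₀ => ?_)
    have hi2 : Integrable (fun y : AngleInterval × AngleInterval => ψ (θ₀, y))
        (volume : Measure (AngleInterval × AngleInterval)) :=
      hψi2 (ψ.comp ⟨fun y => (θ₀, y), by fun_prop⟩)
    beta_reduce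
    rw [Measure.volume_eq_prod, integral_prod _ hi2,
      ← integral_cauchyKernel_mul (f := fun t => f ![circleMap (p 0) R (θ₀ : ℝ), t, z 2])
      (c := p 1) (R := R) ?_ h1, ← integral_const_mul]
    · refine integral_congr_ae (.of_forall fun θ₁ => ?_)
      beta_reduce
      rw [← integral_cauchyKernel_mul (f := fun t => f ![circleMap (p 0) R (θ₀ : ℝ),
        circleMap (p 1) R (θ₁ : ℝ), t]) (c := p 2) (R := R) ?_ h2, ← integral_const_mul,
        ← integral_const_mul]
      · refine integral_congr_ae (.of_forall fun θ₂ => ?_)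
        simp only [hψ, ContinuousMap.mul_apply, hinv z hz]
        simp only [m, φ, γ, ContinuousMap.coe_mk, Matrix.cons_val_zero, Matrix.cons_val_one,
          Matrix.cons_val]
        ring
      · refine (hdiff _ (hvec 2 ![circleMap (p 0) R (θ₀ : ℝ), circleMap (p 1) R (θ₁ : ℝ), 0])
          _ ?_).congr fun t _ => ?_
        · intro t ht
          rw [hm]
          simpa [Function.update] using ⟨hγ _ _, hγ _ _, ht⟩
        · congr 1
          ext i; fin_cases i <;> simp [Function.update]
    · refine (hdiff _ (hvec 1 ![circleMap (p 0) R (θ₀ : ℝ), 0, z 2]) _ ?_).congr fun t _ => ?_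
      · intro t ht
        rw [hm]
        simpa [Function.update] using ⟨hγ _ _, ht, hsub2 h2⟩
      · congr 1
        ext i; fin_cases i <;> simp [Function.update]
  · refine (hdiff _ (hvec 0 ![0, z 1, z 2]) _ ?_).congr fun t _ => ?_
    · intro t ht
      rw [hm]
      simpa [Function.update] using ⟨ht, hsub h1, hsub2 h2⟩
    · congr 1
      ext i; fin_cases i <;> simp [Function.update]

/-! ### Hypersurfaces as level sets of invariants. -/

/-- If the differential of a `C¹` function vanishes on the tangent spaces of a hypersurface near
`p`, then near `p` the hypersurface is a level set of the function. -/
theorem IsDefiningFunctionAt.eventually_mem_iff_level {M : Set C3} {p : C3} {Φ I : C3 → ℝ}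
    (hp : p ∈ M) (hΦ : IsDefiningFunctionAt M p Φ) (hI : ContDiffAt ℝ 1 I p)
    (hI0 : fderiv ℝ I p ≠ 0)
    (htan : ∀ᶠ q in 𝓝 p, q ∈ M → ∀ v, fderiv ℝ Φ q v = 0 → fderiv ℝ I q v = 0) :
    ∀ᶠ q in 𝓝 p, q ∈ M ↔ I q = I p := by
  have hp0 : Φ p = 0 := hΦ.mem_iff.self_of_nhds.1 hp
  have hΦc : ContDiffAt ℝ 1 Φ p := hΦ.analyticAt.contDiffAt
  obtain ⟨n, hn⟩ : ∃ n, fderiv ℝ Φ p n = 1 := by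
    obtain ⟨m, hm⟩ := DFunLike.ne_iff.1 hΦ.fderiv_ne_zero
    exact ⟨(fderiv ℝ Φ p m)⁻¹ • m, by simpa using inv_mul_cancel₀ hm⟩
  set l := fderiv ℝ Φ p with hl
  -- straighten the hypersurface to a hyperplane
  let Ψ : C3 → C3 := fun q => q + (Φ q - l q) • n
  have hlΨ : ∀ q, l (Ψ q) = Φ q := by intro q; simp [Ψ, hn]
  have hΨc : ContDiffAt ℝ 1 Ψ p := by
    refine contDiffAt_id.add ((hΦc.sub l.contDiff.contDiffAt).smul contDiffAt_const)
  have hΨd : HasFDerivAt Ψ ((ContinuousLinearEquiv.refl ℝ C3 : C3 ≃L[ℝ] C3) : C3 →L[ℝ] C3) p := by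
    have h1 : HasFDerivAt Φ l p := (hΦc.differentiableAt one_ne_zero).hasFDerivAt
    have h := (hasFDerivAt_id (𝕜 := ℝ) p).add ((h1.sub (l.hasFDerivAt (x := p))).smul_const n)
    refine h.congr_fderiv ?_
    ext1 v
    simp
  let G := hΨc.toOpenPartialHomeomorph Ψ hΨd one_ne_zero
  have hGΨ : ∀ q, G q = Ψ q := fun q => rfl
  have hps : p ∈ G.source := hΨc.mem_toOpenPartialHomeomorph_source hΨd one_ne_zero
  have hsymmp : G.symm (Ψ p) = p := G.left_inv hps
  have hGs : ContDiffAt ℝ 1 G.symm (Ψ p) := hΨc.to_localInverse hΨd one_ne_zero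
  let J : C3 → ℝ := fun x => I (G.symm x)
  have hJ : ContDiffAt ℝ 1 J (Ψ p) := by
    refine ContDiffAt.comp (Ψ p) ?_ hGs
    rwa [hsymmp]
  have hIJ : ∀ q ∈ G.source, I q = J (Ψ q) := by
    intro q hq
    simp only [J]
    rw [← hGΨ, G.left_inv hq]
  have hchain : ∀ᶠ q in 𝓝 p, ∀ v, fderiv ℝ I q v = fderiv ℝ J (Ψ q) (fderiv ℝ Ψ q v) := by
    have e1 : ∀ᶠ q in 𝓝 p, DifferentiableAt ℝ J (Ψ q) :=
      hΨc.continuousAt.eventually ((hJ.eventually (by simp)).mono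
        fun x hx => hx.differentiableAt one_ne_zero)
    have e2 : ∀ᶠ q in 𝓝 p, DifferentiableAt ℝ Ψ q :=
      (hΨc.eventually (by simp)).mono fun x hx => hx.differentiableAt one_ne_zero
    filter_upwards [e1, e2, G.open_source.mem_nhds hps] with q h1 h2 hq v
    have : I =ᶠ[𝓝 q] J ∘ Ψ := by
      filter_upwards [G.open_source.mem_nhds hq] with y hy using hIJ y hy
    rw [this.fderiv_eq, fderiv_comp q h1 h2]
    rfl
  have hΨp : fderiv ℝ Ψ p = ContinuousLinearMap.id ℝ C3 := hΨd.fderiv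
  have hJp : ∀ v, fderiv ℝ I p v = fderiv ℝ J (Ψ p) v := by
    intro v
    simpa [hΨp] using hchain.self_of_nhds v
  -- the derivative of `J` along the hyperplane vanishes
  have hJtan : ∀ᶠ x in 𝓝 (Ψ p), l x = 0 → ∀ v, l v = 0 → fderiv ℝ J x v = 0 := by
    -- Since $\Phi=l\circ\Psi$ and $d\Psi$ is invertible near $p$, every vector of $\ker l$ is the
    -- image of a vector in $\ker d\Phi$.
    have hsurj : ∀ᶠ q in 𝓝 p, ∀ v, l v = 0 → ∃ u, fderiv ℝ Ψ q u = v ∧ fderiv ℝ Φ q u = 0 := by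
      have e1 : ∀ᶠ q in 𝓝 p, DifferentiableAt ℝ Ψ q :=
        (hΨc.eventually (by simp)).mono fun x hx => hx.differentiableAt one_ne_zero
      have e2 : ∀ᶠ q in 𝓝 p, IsUnit (fderiv ℝ Ψ q) := by
        have hc : ContinuousAt (fderiv ℝ Ψ) p :=
          (hΨc.fderiv_right (m := 0) (by simp)).continuousAt
        refine hc.eventually (Units.isOpen.mem_nhds ?_)
        change IsUnit _
        rw [hΨp]
        exact isUnit_one
      filter_upwards [e1, e2] with q h1 ⟨w, hw⟩ v hv
      refine ⟨(↑w⁻¹ : C3 →L[ℝ] C3) v, ?_, ?_⟩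
      · rw [← hw]
        change ((w : C3 →L[ℝ] C3) * (↑w⁻¹ : C3 →L[ℝ] C3)) v = v
        rw [Units.mul_inv]
        rfl
      · have h3 : fderiv ℝ Φ q = l.comp (fderiv ℝ Ψ q) := by
          have : Φ = l ∘ Ψ := by ext y; exact (hlΨ y).symm
          conv_lhs => rw [this]
          exact (l.hasFDerivAt.comp q h1.hasFDerivAt).fderiv
        rw [h3, ← hw]
        change l (((w : C3 →L[ℝ] C3) * (↑w⁻¹ : C3 →L[ℝ] C3)) v) = 0
        rw [Units.mul_inv]
        exact hv
    have hall := (((hsurj.and hchain).and (htan.and hΦ.mem_iff)))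
    rw [← hsymmp] at hall
    filter_upwards [hGs.continuousAt.eventually hall, G.open_target.mem_nhds (G.map_source hps)]
      with x ⟨⟨h1, h2⟩, h3, h4⟩ hx hlx v hv
    have hxx : Ψ (G.symm x) = x := G.right_inv hx
    obtain ⟨u, hu1, hu2⟩ := h1 v hv
    have hmem : G.symm x ∈ M := h4.2 (by rw [← hlΨ, hxx, hlx])
    have := h3 hmem u hu2
    rw [h2 u, hu1, hxx] at this
    exact this
  -- The differential of `J` at `Ψ p` is nonzero but vanishes on $\ker l$, so it cannot vanish on
  -- the transversal vector `n`.
  have hJn : fderiv ℝ J (Ψ p) n ≠ 0 := by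
    intro h0
    refine hI0 (ContinuousLinearMap.ext fun v => ?_)
    rw [hJp]
    have h1 : v = (v - l v • n) + l v • n := by abel
    have h2 : fderiv ℝ J (Ψ p) (v - l v • n) = 0 :=
      hJtan.self_of_nhds (by rw [hlΨ, hp0]) _ (by simp [hn])
    rw [h1, map_add, map_smul, h2, h0]
    simp
  have hJne : ∀ᶠ x in 𝓝 (Ψ p), fderiv ℝ J x n ≠ 0 := by
    have hc : ContinuousAt (fun x => fderiv ℝ J x n) (Ψ p) :=
      (hJ.fderiv_right (m := 0) (by simp)).continuousAt.clm_apply continuousAt_const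
    exact hc.eventually_ne hJn
  have hJdiff : ∀ᶠ x in 𝓝 (Ψ p), DifferentiableAt ℝ J x :=
    (hJ.eventually (by simp)).mono fun x hx => hx.differentiableAt one_ne_zero
  obtain ⟨ε, hε, hball⟩ := Metric.eventually_nhds_iff_ball.1 (hJtan.and (hJne.and hJdiff))
  have hconst : ∀ x ∈ Metric.ball (Ψ p) ε, l x = 0 → J x = J (Ψ p) := by
    intro x hx hlx
    have hseg : ∀ t ∈ Set.Icc (0 : ℝ) 1, AffineMap.lineMap (Ψ p) x t ∈ Metric.ball (Ψ p) ε :=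
      fun t ht => (convex_ball _ _).lineMap_mem (Metric.mem_ball_self hε) hx ht
    have hd : ∀ t ∈ Set.Icc (0 : ℝ) 1,
        HasDerivWithinAt (fun t : ℝ => J (AffineMap.lineMap (Ψ p) x t)) 0 (Set.Icc 0 1) t := by
      intro t ht
      obtain ⟨h1, -, h3⟩ := hball _ (hseg t ht)
      have h4 := h3.hasFDerivAt.comp_hasDerivAt t
        (AffineMap.hasDerivAt_lineMap (a := Ψ p) (b := x) (x := t))
      have hl0 : l (AffineMap.lineMap (Ψ p) x t) = 0 := by
        simp [AffineMap.lineMap_apply, hlΨ, hp0, hlx]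
      rw [h1 hl0 (x - Ψ p) (by simp [hlΨ, hp0, hlx])] at h4
      exact h4.hasDerivWithinAt
    have := constant_of_has_deriv_right_zero (f := fun t : ℝ => J (AffineMap.lineMap (Ψ p) x t))
      (a := 0) (b := 1) (fun t ht => (hd t ht).continuousWithinAt)
      (fun t ht => ((hd t ⟨ht.1, ht.2.le⟩).mono_of_mem_nhdsWithin
        (Icc_mem_nhdsGE_of_mem ht))) 1 (by simp)
    simpa using this
  have hproj : ContinuousAt (fun q => Ψ q - l (Ψ q) • n) p :=
    hΨc.continuousAt.sub ((l.continuous.continuousAt.comp hΨc.continuousAt).smul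
      continuousAt_const)
  have hprojp : Ψ p - l (Ψ p) • n = Ψ p := by simp [hlΨ, hp0]
  have e1 : ∀ᶠ q in 𝓝 p, Ψ q - l (Ψ q) • n ∈ Metric.ball (Ψ p) ε :=
    hproj.eventually (by beta_reduce; rw [hprojp]; exact Metric.ball_mem_nhds _ hε)
  have e2 : ∀ᶠ q in 𝓝 p, Ψ q ∈ Metric.ball (Ψ p) ε :=
    hΨc.continuousAt.eventually (Metric.ball_mem_nhds _ hε)
  filter_upwards [e1, e2, hΦ.mem_iff, G.open_source.mem_nhds hps] with q h1 h2 h3 hq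
  rw [h3, hIJ q hq, hIJ p hps]
  constructor
  · intro h
    exact hconst _ h2 (by rw [hlΨ, h])
  · intro h
    -- Off the hyperplane, compare with the projection along `n`: `J` would take equal values at
    -- both ends of the segment, and Rolle's theorem contradicts the nonvanishing derivative along
    -- `n`.
    by_contra hne
    have hb : J (Ψ q - l (Ψ q) • n) = J (Ψ p) := hconst _ h1 (by simp [hn])
    have hseg : ∀ t ∈ Set.Icc (0 : ℝ) 1,
        AffineMap.lineMap (Ψ q - l (Ψ q) • n) (Ψ q) t ∈ Metric.ball (Ψ p) ε :=
      fun t ht => (convex_ball _ _).lineMap_mem h1 h2 ht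
    have hd : ∀ t ∈ Set.Icc (0 : ℝ) 1, HasDerivAt
        (fun t : ℝ => J (AffineMap.lineMap (Ψ q - l (Ψ q) • n) (Ψ q) t))
        (fderiv ℝ J (AffineMap.lineMap (Ψ q - l (Ψ q) • n) (Ψ q) t) (l (Ψ q) • n)) t := by
      intro t ht
      obtain ⟨-, -, h5⟩ := hball _ (hseg t ht)
      have h4 := h5.hasFDerivAt.comp_hasDerivAt t
        (AffineMap.hasDerivAt_lineMap (a := Ψ q - l (Ψ q) • n) (b := Ψ q) (x := t))
      rw [sub_sub_cancel] at h4
      exact h4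
    obtain ⟨t, ht, ht0⟩ := exists_hasDerivAt_eq_zero (a := 0) (b := 1) one_pos
      (f := fun t : ℝ => J (AffineMap.lineMap (Ψ q - l (Ψ q) • n) (Ψ q) t))
      (fun t ht => (hd t ht).continuousAt.continuousWithinAt)
      (by simp [hb, h]) (fun t ht => hd t (Set.Ioo_subset_Icc_self ht))
    rw [map_smul, smul_eq_mul, mul_eq_zero] at ht0
    exact ht0.elim (by rwa [hlΨ]) (hball _ (hseg t (Set.Ioo_subset_Icc_self ht))).2.1

/-- If two functions `r`, `s` are multiplied by the same factor by every tangential derivative of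
a hypersurface near `p`, then the hypersurface is given near `p` by `r = c s` for a constant
`c`. -/
theorem IsDefiningFunctionAt.exists_eventually_mem_iff {M : Set C3} {p ξ : C3} {Φ r s : C3 → ℝ}
    (hp : p ∈ M) (hΦ : IsDefiningFunctionAt M p Φ) (hr : ContDiffAt ℝ 1 r p)
    (hs : ContDiffAt ℝ 1 s p) (hs0 : s p ≠ 0) (hrξ : fderiv ℝ r p ξ ≠ 0)
    (hsξ : fderiv ℝ s p ξ = 0)
    (htan : ∀ᶠ q in 𝓝 p, q ∈ M → ∀ v, fderiv ℝ Φ q v = 0 →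
      ∃ a : ℝ, fderiv ℝ r q v = a * r q ∧ fderiv ℝ s q v = a * s q) :
    ∃ c : ℝ, ∀ᶠ q in 𝓝 p, q ∈ M ↔ r q = c * s q := by
  have hsn : ∀ᶠ q in 𝓝 p, s q ≠ 0 := hs.continuousAt.eventually_ne hs0
  have hd : ∀ᶠ q in 𝓝 p, ∀ v, fderiv ℝ (fun q => r q / s q) q v =
      (s q * fderiv ℝ r q v - r q * fderiv ℝ s q v) / s q ^ 2 := by
    filter_upwards [hsn, hr.eventually (by simp), hs.eventually (by simp)] with q h1 h2 h3 v
    have h4 := (h2.differentiableAt one_ne_zero).hasFDerivAt.mul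
      ((hasDerivAt_inv h1).comp_hasFDerivAt q (h3.differentiableAt one_ne_zero).hasFDerivAt)
    have h5 : HasFDerivAt (fun q => r q / s q) _ q := h4
    rw [h5.fderiv]
    simp
    field_simp
    ring
  -- The common factor cancels in the derivative of $r/s$ along $M$, while `ξ` witnesses that
  -- $d(r/s)\neq0$ at $p$.
  have h := hΦ.eventually_mem_iff_level (I := fun q => r q / s q) hp (hr.div hs hs0) ?_ ?_
  · refine ⟨r p / s p, ?_⟩
    filter_upwards [h, hsn] with q hq hsq
    rw [hq, div_eq_iff hsq]
  · intro h0
    have h1 := hd.self_of_nhds ξ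
    rw [h0, hsξ] at h1
    have h2 : s p * fderiv ℝ r p ξ / s p ^ 2 ≠ 0 := by positivity
    exact h2 (by simpa using h1.symm)
  · filter_upwards [htan, hd] with q h1 h2 hq v hv
    obtain ⟨a, ha, hb⟩ := h1 hq v hv
    rw [h2, ha, hb]
    ring

/-! ### Hessians and degeneracy of the Levi form. -/

/-- The Hessian of a function at `p`, applied to two vectors. -/
abbrev hess (f : C3 → ℝ) (p a b : C3) : ℝ := fderiv ℝ (fderiv ℝ f) p a b

theorem hess_eq_of_eventually {f : C3 → ℝ} {p b : C3} {g : C3 → ℝ} {g' : C3 →L[ℝ] ℝ}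
    (hf : ContDiffAt ℝ 2 f p) (h : ∀ᶠ q in 𝓝 p, fderiv ℝ f q b = g q)
    (hg : HasFDerivAt g g' p) (a : C3) : hess f p a b = g' a := by
  have h1 : DifferentiableAt ℝ (fderiv ℝ f) p :=
    (hf.fderiv_right (m := 1) (by norm_num)).differentiableAt one_ne_zero
  have h2 := h1.hasFDerivAt.clm_apply (hasFDerivAt_const b p)
  have h3 := hg.congr_of_eventuallyEq h
  have h4 := DFunLike.congr_fun (h2.unique h3) a
  simpa using h4

theorem AnalyticAt.eventually_hasFDerivAt_real {f : C3 → ℂ} {p : C3} (hf : AnalyticAt ℂ f p) :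
    ∀ᶠ q in 𝓝 p, HasFDerivAt f ((fderiv ℂ f q).restrictScalars ℝ) q :=
  hf.eventually_analyticAt.mono fun _ hq =>
    hq.differentiableAt.hasFDerivAt.restrictScalars ℝ

theorem AnalyticAt.hasFDerivAt_fderiv_apply {f : C3 → ℂ} {p : C3} (hf : AnalyticAt ℂ f p)
    (b : C3) : HasFDerivAt (fun q => fderiv ℂ f q b)
      ((((ContinuousLinearMap.apply ℂ ℂ b).comp (fderiv ℂ (fderiv ℂ f) p))).restrictScalars ℝ) p := by
  have h := (ContinuousLinearMap.apply ℂ ℂ b).hasFDerivAt.comp p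
    hf.fderiv.differentiableAt.hasFDerivAt
  exact h.restrictScalars ℝ

theorem AnalyticAt.im_real {f : C3 → ℂ} {p : C3} (hf : AnalyticAt ℂ f p) :
    AnalyticAt ℝ (fun q => (f q).im) p :=
  (Complex.imCLM.analyticAt _).comp (hf.restrictScalars (𝕜 := ℝ))

theorem AnalyticAt.re_real {f : C3 → ℂ} {p : C3} (hf : AnalyticAt ℂ f p) :
    AnalyticAt ℝ (fun q => (f q).re) p :=
  (Complex.reCLM.analyticAt _).comp (hf.restrictScalars (𝕜 := ℝ))

theorem AnalyticAt.norm_sq_real {f : C3 → ℂ} {p : C3} (hf : AnalyticAt ℂ f p) :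
    AnalyticAt ℝ (fun q => ‖f q‖ ^ 2) p := by
  simp only [Complex.sq_norm, Complex.normSq_apply]
  exact (hf.re_real.mul hf.re_real).add (hf.im_real.mul hf.im_real)

theorem HasFDerivAt.im_real {f : C3 → ℂ} {q : C3} {f' : C3 →L[ℝ] ℂ} (hf : HasFDerivAt f f' q) :
    HasFDerivAt (fun q => (f q).im) (Complex.imCLM.comp f') q :=
  Complex.imCLM.hasFDerivAt.comp q hf

theorem HasFDerivAt.re_real {f : C3 → ℂ} {q : C3} {f' : C3 →L[ℝ] ℂ} (hf : HasFDerivAt f f' q) :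
    HasFDerivAt (fun q => (f q).re) (Complex.reCLM.comp f') q :=
  Complex.reCLM.hasFDerivAt.comp q hf

theorem fderiv_norm_sq_real {f : C3 → ℂ} {q : C3} {f' : C3 →L[ℝ] ℂ} (hf : HasFDerivAt f f' q)
    (b : C3) : fderiv ℝ (fun q => ‖f q‖ ^ 2) q b =
      2 * ((f q).re * (f' b).re + (f q).im * (f' b).im) := by
  simp only [Complex.sq_norm, Complex.normSq_apply]
  have h : HasFDerivAt (fun q => (f q).re * (f q).re + (f q).im * (f q).im) _ q :=
    (hf.re_real.mul hf.re_real).add (hf.im_real.mul hf.im_real)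
  rw [h.fderiv]
  simp
  ring

theorem hess_im {W : C3 → ℂ} {p : C3} (hW : AnalyticAt ℂ W p) (a b : C3) :
    hess (fun q => (W q).im) p a b = (fderiv ℂ (fderiv ℂ W) p a b).im := by
  have h := hess_eq_of_eventually (b := b) (g := fun q => (fderiv ℂ W q b).im)
    hW.im_real.contDiffAt
    (hW.eventually_hasFDerivAt_real.mono fun q hq => by rw [hq.im_real.fderiv]; rfl)
    (hW.hasFDerivAt_fderiv_apply b).im_real a
  rw [h]
  rfl

/-- The product $dZ(a)\,\overline{dZ(b)}$, which carries the Levi form of $|Z|^2$, drops out because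
$dZ(a)=0$; what is left is the real part of a complex bilinear form. -/
theorem hess_norm_sq {Z : C3 → ℂ} {p a : C3} (hZ : AnalyticAt ℂ Z p) (ha : fderiv ℂ Z p a = 0)
    (b : C3) : hess (fun q => ‖Z q‖ ^ 2) p a b =
      2 * (starRingEnd ℂ (Z p) * fderiv ℂ (fderiv ℂ Z) p a b).re := by
  have hZ1 := hZ.eventually_hasFDerivAt_real.self_of_nhds
  have hZ2 := hZ.hasFDerivAt_fderiv_apply b
  have h := hess_eq_of_eventually (b := b)
    (g := fun q => 2 * ((Z q).re * (fderiv ℂ Z q b).re + (Z q).im * (fderiv ℂ Z q b).im))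
    hZ.norm_sq_real.contDiffAt
    (hZ.eventually_hasFDerivAt_real.mono fun q hq => fderiv_norm_sq_real hq b)
    (((hZ1.re_real.mul hZ2.re_real).add (hZ1.im_real.mul hZ2.im_real)).const_mul 2) a
  rw [h]
  simp [ha]
  ring

/-- The Levi form extracts the sesquilinear part of the Hessian, and the imaginary part of a complex
bilinear form has none. -/
theorem leviForm_eq_zero_of_hess {Φ : C3 → ℝ} {p ξ : C3} (Q : C3 →L[ℂ] C3 →L[ℂ] ℂ)
    (h1 : ∀ b, hess Φ p ξ b = (Q ξ b).im)
    (h2 : ∀ b, hess Φ p (Complex.I • ξ) b = (Q (Complex.I • ξ) b).im) (η : C3) :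
    leviForm Φ p ξ η = 0 := by
  simp only [hess] at h1 h2
  simp only [leviForm, h1, h2]
  simp

/-- A hypersurface `Im W = κ₁ |Z₁|² + κ₂ |Z₂|²` has a degenerate Levi form if there is a
complex tangent direction in which `W` and each `Z_i` with `κ_i ≠ 0` are stationary. -/
theorem IsLeviNondegenerate.eq_zero_of_stationary {M : Set C3} {p ξ v : C3} {Z₁ Z₂ W : C3 → ℂ}
    {κ₁ κ₂ : ℝ} (hLevi : IsLeviNondegenerate M) (hp : p ∈ M) (hZ₁ : AnalyticAt ℂ Z₁ p)
    (hZ₂ : AnalyticAt ℂ Z₂ p) (hW : AnalyticAt ℂ W p)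
    (hM : ∀ᶠ q in 𝓝 p, q ∈ M ↔ (W q).im = κ₁ * ‖Z₁ q‖ ^ 2 + κ₂ * ‖Z₂ q‖ ^ 2)
    (hv : fderiv ℂ W p v ≠ 0) (hv₁ : κ₁ = 0 ∨ fderiv ℂ Z₁ p v = 0)
    (hv₂ : κ₂ = 0 ∨ fderiv ℂ Z₂ p v = 0) (hξ : fderiv ℂ W p ξ = 0)
    (hξ₁ : κ₁ = 0 ∨ fderiv ℂ Z₁ p ξ = 0) (hξ₂ : κ₂ = 0 ∨ fderiv ℂ Z₂ p ξ = 0) : ξ = 0 := by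
  let Φ : C3 → ℝ := fun q => (W q).im - (κ₁ * ‖Z₁ q‖ ^ 2 + κ₂ * ‖Z₂ q‖ ^ 2)
  have hn : ∀ {κ : ℝ} {Z : C3 → ℂ}, AnalyticAt ℂ Z p →
      AnalyticAt ℝ (fun q => κ * ‖Z q‖ ^ 2) p := fun hZ => analyticAt_const.mul hZ.norm_sq_real
  have hΦa : AnalyticAt ℝ Φ p := hW.im_real.sub ((hn hZ₁).add (hn hZ₂))
  have hd : ∀ᶠ q in 𝓝 p, fderiv ℝ Φ q = fderiv ℝ (fun q => (W q).im) q -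
      (κ₁ • fderiv ℝ (fun q => ‖Z₁ q‖ ^ 2) q + κ₂ • fderiv ℝ (fun q => ‖Z₂ q‖ ^ 2) q) := by
    filter_upwards [hW.im_real.eventually_analyticAt, hZ₁.norm_sq_real.eventually_analyticAt,
      hZ₂.norm_sq_real.eventually_analyticAt] with q h1 h2 h3
    exact (h1.differentiableAt.hasFDerivAt.sub ((h2.differentiableAt.hasFDerivAt.const_mul κ₁).add
      (h3.differentiableAt.hasFDerivAt.const_mul κ₂))).fderiv
  have hstat : ∀ u, (κ₁ = 0 ∨ fderiv ℂ Z₁ p u = 0) → (κ₂ = 0 ∨ fderiv ℂ Z₂ p u = 0) →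
      fderiv ℝ Φ p u = (fderiv ℂ W p u).im := by
    intro u h1 h2
    rw [hd.self_of_nhds]
    simp only [sub_apply, add_apply,
      smul_apply, smul_eq_mul]
    rw [fderiv_norm_sq_real hZ₁.eventually_hasFDerivAt_real.self_of_nhds,
      fderiv_norm_sq_real hZ₂.eventually_hasFDerivAt_real.self_of_nhds,
      hW.eventually_hasFDerivAt_real.self_of_nhds.im_real.fderiv]
    rcases h1 with h1 | h1 <;> rcases h2 with h2 | h2 <;> simp [h1, h2]
  have hΦ : IsDefiningFunctionAt M p Φ := by
    refine ⟨hΦa, ?_, ?_⟩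
    · intro h0
      -- On this multiple of `v` the differential of `W` equals $i$, so that of `Φ` equals 1.
      have h1 := hstat ((Complex.I / fderiv ℂ W p v) • v) (hv₁.imp_right fun h => by simp [h])
        (hv₂.imp_right fun h => by simp [h])
      rw [h0, (fderiv ℂ W p).map_smul, smul_eq_mul, div_mul_cancel₀ _ hv] at h1
      simp at h1
    · filter_upwards [hM] with q hq
      rw [hq, sub_eq_zero]
  have hH : ∀ a b, hess Φ p a b = hess (fun q => (W q).im) p a b -
      (κ₁ * hess (fun q => ‖Z₁ q‖ ^ 2) p a b + κ₂ * hess (fun q => ‖Z₂ q‖ ^ 2) p a b) := by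
    intro a b
    have h1 := hW.im_real.fderiv.differentiableAt.hasFDerivAt
    have h2 := hZ₁.norm_sq_real.fderiv.differentiableAt.hasFDerivAt
    have h3 := hZ₂.norm_sq_real.fderiv.differentiableAt.hasFDerivAt
    have h4 := (h1.sub ((h2.const_smul κ₁).add (h3.const_smul κ₂))).congr_of_eventuallyEq hd
    simp only [hess]
    rw [h4.fderiv]
    simp
  -- The factors $i$ come from $\operatorname{Re}u=\operatorname{Im}(iu)$, which brings all terms
  -- into the form required by `leviForm_eq_zero_of_hess`.
  let Q : C3 →L[ℂ] C3 →L[ℂ] ℂ := fderiv ℂ (fderiv ℂ W) p -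
    ((2 * κ₁ * Complex.I * starRingEnd ℂ (Z₁ p)) • fderiv ℂ (fderiv ℂ Z₁) p +
      (2 * κ₂ * Complex.I * starRingEnd ℂ (Z₂ p)) • fderiv ℂ (fderiv ℂ Z₂) p)
  have hQ : ∀ a, (κ₁ = 0 ∨ fderiv ℂ Z₁ p a = 0) → (κ₂ = 0 ∨ fderiv ℂ Z₂ p a = 0) →
      ∀ b, hess Φ p a b = (Q a b).im := by
    intro a h1 h2 b
    have e : ∀ {κ : ℝ} {Z : C3 → ℂ}, AnalyticAt ℂ Z p → (κ = 0 ∨ fderiv ℂ Z p a = 0) →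
        κ * hess (fun q => ‖Z q‖ ^ 2) p a b =
        (2 * κ * Complex.I * starRingEnd ℂ (Z p) * fderiv ℂ (fderiv ℂ Z) p a b).im := by
      intro κ Z hZ h
      rcases h with rfl | h
      · simp
      · rw [hess_norm_sq hZ h]
        simp
        ring
    rw [hH, hess_im hW, e hZ₁ h1, e hZ₂ h2]
    simp [Q]
  refine hLevi p hp Φ hΦ ξ ?_ fun η _ => leviForm_eq_zero_of_hess Q (hQ ξ hξ₁ hξ₂) (hQ _ ?_ ?_) η
  · refine ⟨?_, ?_⟩
    · rw [hstat ξ hξ₁ hξ₂, hξ, Complex.zero_im]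
    · rw [hstat _ (hξ₁.imp_right fun h => by simp [h]) (hξ₂.imp_right fun h => by simp [h])]
      simp [hξ]
  · exact hξ₁.imp_right fun h => by simp [h]
  · exact hξ₂.imp_right fun h => by simp [h]

/-! ### Normalization to a quadric. -/

/-- `M` is biholomorphic to an open piece of `Q` near `p`. -/
def IsBiholomorphicNear (M Q : Set C3) (p : C3) : Prop :=
  ∃ F : OpenPartialHomeomorph C3 C3, p ∈ F.source ∧
    DifferentiableOn ℂ F F.source ∧ DifferentiableOn ℂ F.symm F.target ∧ F.IsImage M Q

theorem isBiholomorphicNear_of_coordinates {M Q : Set C3} {p : C3} {f₀ f₁ f₂ : C3 → ℂ}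
    (h₀ : AnalyticAt ℂ f₀ p) (h₁ : AnalyticAt ℂ f₁ p) (h₂ : AnalyticAt ℂ f₂ p)
    (hinj : ∀ ξ, fderiv ℂ f₀ p ξ = 0 → fderiv ℂ f₁ p ξ = 0 → fderiv ℂ f₂ p ξ = 0 → ξ = 0)
    (hM : ∀ᶠ q in 𝓝 p, q ∈ M ↔ ![f₀ q, f₁ q, f₂ q] ∈ Q) : IsBiholomorphicNear M Q p := by
  let F : C3 → C3 := fun q => ![f₀ q, f₁ q, f₂ q]
  have hF : AnalyticAt ℂ F p := by
    rw [analyticAt_pi_iff]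
    intro i
    fin_cases i
    exacts [h₀, h₁, h₂]
  have hd : ∀ i, fderiv ℂ (fun q => F q i) p =
      (ContinuousLinearMap.proj (R := ℂ) (φ := fun _ : Fin 3 => ℂ) i).comp (fderiv ℂ F p) :=
    fun i => ((ContinuousLinearMap.proj (R := ℂ) (φ := fun _ : Fin 3 => ℂ) i).hasFDerivAt.comp p
      hF.differentiableAt.hasFDerivAt).fderiv
  have hinj' : Function.Injective (fderiv ℂ F p : C3 →ₗ[ℂ] C3) := by
    rw [injective_iff_map_eq_zero]
    intro ξ hξ
    have hc : ∀ i, fderiv ℂ (fun q => F q i) p ξ = 0 := by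
      intro i
      rw [hd]
      exact congrFun hξ i
    exact hinj ξ (hc 0) (hc 1) (hc 2)
  let e : C3 ≃L[ℂ] C3 := (LinearEquiv.ofInjectiveEndo _ hinj').toContinuousLinearEquiv
  have he : HasFDerivAt F (e : C3 →L[ℂ] C3) p :=
    hF.differentiableAt.hasFDerivAt.congr_fderiv (by ext v; rfl)
  have hFc : ContDiffAt ℂ 1 F p := hF.contDiffAt
  let G := hFc.toOpenPartialHomeomorph F he one_ne_zero
  have hps : p ∈ G.source := hFc.mem_toOpenPartialHomeomorph_source he one_ne_zero
  have hGs : ContDiffAt ℂ 1 G.symm (F p) := hFc.to_localInverse he one_ne_zero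
  have hev : ∀ᶠ q in 𝓝 p, (q ∈ M ↔ F q ∈ Q) ∧ DifferentiableAt ℂ F q ∧
      DifferentiableAt ℂ G.symm (F q) := by
    refine hM.and ((hF.eventually_analyticAt.mono fun q hq => hq.differentiableAt).and ?_)
    exact hFc.continuousAt.eventually ((hGs.eventually (by simp)).mono
      fun x hx => hx.differentiableAt one_ne_zero)
  obtain ⟨O, hO, hOo, hpO⟩ := eventually_nhds_iff.1 hev
  refine ⟨G.restrOpen O hOo, ⟨hps, hpO⟩, ?_, ?_, ?_⟩
  · intro q hq
    exact (hO q hq.2).2.1.differentiableWithinAt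
  · intro x hx
    have h1 : x ∈ G.target := hx.1
    have h2 : G.symm x ∈ O := hx.2
    have h3 := (hO _ h2).2.2
    have h4 : F (G.symm x) = x := G.right_inv h1
    rw [h4] at h3
    exact h3.differentiableWithinAt
  · intro q hq
    exact (hO q hq.2).1.symm

/-- A Levi-nondegenerate hypersurface of the form `Im W = κ₁ |Z₁|² + κ₂ |Z₂|²` in local holomorphic
coordinates is locally biholomorphic to one of the two quadrics. -/
theorem IsLeviNondegenerate.isBiholomorphicNear_quadric {M : Set C3} {p : C3} {Z₁ Z₂ W : C3 → ℂ}
    {κ₁ κ₂ : ℝ} (hLevi : IsLeviNondegenerate M) (hp : p ∈ M) (hZ₁ : AnalyticAt ℂ Z₁ p)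
    (hZ₂ : AnalyticAt ℂ Z₂ p) (hW : AnalyticAt ℂ W p)
    (hM : ∀ᶠ q in 𝓝 p, q ∈ M ↔ (W q).im = κ₁ * ‖Z₁ q‖ ^ 2 + κ₂ * ‖Z₂ q‖ ^ 2)
    (hsurj : ∀ a b c : ℂ, ∃ ξ, fderiv ℂ Z₁ p ξ = a ∧ fderiv ℂ Z₂ p ξ = b ∧ fderiv ℂ W p ξ = c) :
    IsBiholomorphicNear M (quadric 1) p ∨ IsBiholomorphicNear M (quadric (-1)) p := by
  have hinj : ∀ ξ, fderiv ℂ Z₁ p ξ = 0 → fderiv ℂ Z₂ p ξ = 0 → fderiv ℂ W p ξ = 0 → ξ = 0 := by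
    let L : C3 →ₗ[ℂ] C3 := LinearMap.pi ![(fderiv ℂ Z₁ p : C3 →ₗ[ℂ] ℂ),
      (fderiv ℂ Z₂ p : C3 →ₗ[ℂ] ℂ), (fderiv ℂ W p : C3 →ₗ[ℂ] ℂ)]
    have hL : Function.Surjective L := by
      intro y
      obtain ⟨ξ, h1, h2, h3⟩ := hsurj (y 0) (y 1) (y 2)
      refine ⟨ξ, ?_⟩
      ext i
      fin_cases i
      exacts [h1, h2, h3]
    have hL' := LinearMap.injective_iff_surjective.2 hL
    intro ξ h1 h2 h3
    refine (injective_iff_map_eq_zero L).1 hL' ξ ?_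
    ext i
    fin_cases i
    exacts [h1, h2, h3]
  obtain ⟨v, hv1, hv2, hv3⟩ := hsurj 0 0 1
  -- If $\kappa_1=0$, the direction along which only $Z_1$ varies to first order would be Levi-null.
  have hκ₁ : κ₁ ≠ 0 := by
    intro h
    obtain ⟨ξ, h1, h2, h3⟩ := hsurj 1 0 0
    have := hLevi.eq_zero_of_stationary (v := v) (ξ := ξ) hp hZ₁ hZ₂ hW hM (by simp [hv3])
      (.inl h) (.inr hv2) h3 (.inl h) (.inr h2)
    rw [this, map_zero] at h1
    exact zero_ne_one h1
  have hκ₂ : κ₂ ≠ 0 := by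
    intro h
    obtain ⟨ξ, h1, h2, h3⟩ := hsurj 0 1 0
    have := hLevi.eq_zero_of_stationary (v := v) (ξ := ξ) hp hZ₁ hZ₂ hW hM (by simp [hv3])
      (.inr hv1) (.inl h) h3 (.inr h1) (.inl h)
    rw [this, map_zero] at h2
    exact zero_ne_one h2
  have hmul : ∀ (c : ℝ) {f : C3 → ℂ}, AnalyticAt ℂ f p →
      AnalyticAt ℂ (fun q => (c : ℂ) * f q) p := fun c f hf => analyticAt_const.mul hf
  have hder : ∀ (c : ℝ) {f : C3 → ℂ}, c ≠ 0 → AnalyticAt ℂ f p → ∀ ξ,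
      fderiv ℂ (fun q => (c : ℂ) * f q) p ξ = 0 → fderiv ℂ f p ξ = 0 := by
    intro c f hc hf ξ h
    rw [fderiv_const_mul hf.differentiableAt] at h
    simpa [hc] using h
  have hsq : ∀ (c : ℝ) (z : ℂ), 0 ≤ c → ‖((√c : ℝ) : ℂ) * z‖ ^ 2 = c * ‖z‖ ^ 2 := by
    intro c z hc
    rw [norm_mul, mul_pow, Complex.norm_real, Real.norm_eq_abs, sq_abs, Real.sq_sqrt hc]
  rcases lt_or_gt_of_ne hκ₁ with h1 | h1 <;> rcases lt_or_gt_of_ne hκ₂ with h2 | h2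
  · left
    have n1 : √(-κ₁) ≠ 0 := (Real.sqrt_pos.2 (by linarith)).ne'
    have n2 : √(-κ₂) ≠ 0 := (Real.sqrt_pos.2 (by linarith)).ne'
    -- Both coefficients are negative, so $W$ is replaced by $-W$.
    refine isBiholomorphicNear_of_coordinates (hmul (√(-κ₁)) hZ₁) (hmul (√(-κ₂)) hZ₂)
      (hmul (-1) hW) (fun ξ a b c => hinj ξ (hder _ n1 hZ₁ ξ a) (hder _ n2 hZ₂ ξ b)
        (hder _ (by norm_num) hW ξ c)) ?_
    filter_upwards [hM] with q hq
    rw [hq]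
    simp only [quadric, Set.mem_ofPred_eq, Matrix.cons_val_zero, Matrix.cons_val_one,
      Matrix.cons_val, hsq (-κ₁) _ (by linarith), hsq (-κ₂) _ (by linarith),
      Complex.im_ofReal_mul]
    constructor <;> intro h <;> linarith
  · right
    have n1 : √(-κ₁) ≠ 0 := (Real.sqrt_pos.2 (by linarith)).ne'
    have n2 : √κ₂ ≠ 0 := (Real.sqrt_pos.2 (by linarith)).ne'
    -- The variables are exchanged so that the positive square comes first.
    refine isBiholomorphicNear_of_coordinates (hmul (√κ₂) hZ₂) (hmul (√(-κ₁)) hZ₁)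
      hW (fun ξ a b c => hinj ξ (hder _ n1 hZ₁ ξ b) (hder _ n2 hZ₂ ξ a) c) ?_
    filter_upwards [hM] with q hq
    rw [hq]
    simp only [quadric, Set.mem_ofPred_eq, Matrix.cons_val_zero, Matrix.cons_val_one,
      Matrix.cons_val, hsq (-κ₁) _ (by linarith), hsq κ₂ _ h2.le]
    constructor <;> intro h <;> linarith
  · right
    have n1 : √κ₁ ≠ 0 := (Real.sqrt_pos.2 (by linarith)).ne'
    have n2 : √(-κ₂) ≠ 0 := (Real.sqrt_pos.2 (by linarith)).ne'
    refine isBiholomorphicNear_of_coordinates (hmul (√κ₁) hZ₁) (hmul (√(-κ₂)) hZ₂)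
      hW (fun ξ a b c => hinj ξ (hder _ n1 hZ₁ ξ a) (hder _ n2 hZ₂ ξ b) c) ?_
    filter_upwards [hM] with q hq
    rw [hq]
    simp only [quadric, Set.mem_ofPred_eq, Matrix.cons_val_zero, Matrix.cons_val_one,
      Matrix.cons_val, hsq (-κ₂) _ (by linarith), hsq κ₁ _ h1.le]
    constructor <;> intro h <;> linarith
  · left
    have n1 : √κ₁ ≠ 0 := (Real.sqrt_pos.2 (by linarith)).ne'
    have n2 : √κ₂ ≠ 0 := (Real.sqrt_pos.2 (by linarith)).ne'
    refine isBiholomorphicNear_of_coordinates (hmul (√κ₁) hZ₁) (hmul (√κ₂) hZ₂)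
      hW (fun ξ a b c => hinj ξ (hder _ n1 hZ₁ ξ a) (hder _ n2 hZ₂ ξ b) c) ?_
    filter_upwards [hM] with q hq
    rw [hq]
    simp only [quadric, Set.mem_ofPred_eq, Matrix.cons_val_zero, Matrix.cons_val_one,
      Matrix.cons_val, hsq κ₂ _ h2.le, hsq κ₁ _ h1.le]
    constructor <;> intro h <;> linarith

/-! ### Inequivalence of the two quadrics and constancy of the sign. -/

/-- A holomorphic disc in the strictly pseudoconvex quadric is stationary at its centre. -/
theorem deriv_eq_zero_of_mem_quadric_one {ψ : ℂ → C3} (hψ : ∀ᶠ t in 𝓝 0, DifferentiableAt ℂ ψ t)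
    (hQ : ∀ᶠ t in 𝓝 0, ψ t ∈ quadric 1) : deriv ψ 0 = 0 := by
  set c := ψ 0 with hc
  -- On the quadric $\operatorname{Re}H=|\psi_0-c_0|^2+|\psi_1-c_1|^2$, so $|e^{-H}|$ is maximal at
  -- $0$ and the maximum principle applies.
  let H : ℂ → ℂ := fun t => -Complex.I * ψ t 2 -
    2 * (starRingEnd ℂ (c 0) * ψ t 0 + starRingEnd ℂ (c 1) * ψ t 1) +
    ((‖c 0‖ ^ 2 + ‖c 1‖ ^ 2 : ℝ) : ℂ)
  have hcomp : ∀ i, ∀ᶠ t in 𝓝 0, DifferentiableAt ℂ (fun t => ψ t i) t := fun i =>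
    hψ.mono fun t ht => differentiableAt_pi.1 ht i
  have hHd : ∀ᶠ t in 𝓝 0, DifferentiableAt ℂ H t := by
    filter_upwards [hcomp 0, hcomp 1, hcomp 2] with t h0 h1 h2
    exact ((h2.const_mul _).sub (((h0.const_mul _).add (h1.const_mul _)).const_mul 2)).add_const _
  have hHre : ∀ᶠ t in 𝓝 0, (H t).re = ‖ψ t 0 - c 0‖ ^ 2 + ‖ψ t 1 - c 1‖ ^ 2 := by
    filter_upwards [hQ] with t ht
    simp only [quadric, Set.mem_ofPred_eq] at ht
    simp only [Complex.sq_norm, Complex.normSq_apply] at ht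
    simp [H, Complex.sq_norm, Complex.normSq_apply, ht]
    norm_cast
    ring
  have hconst : ∀ᶠ t in 𝓝 0, Complex.exp (-H t) = Complex.exp (-H 0) := by
    refine Complex.eventually_eq_of_isLocalMax_norm (f := fun t => Complex.exp (-H t))
      (hHd.mono fun t ht => ht.neg.cexp) ?_
    filter_upwards [hHre] with t ht
    have h0 := hHre.self_of_nhds
    simp only [Function.comp, Complex.norm_exp, Real.exp_le_exp, Complex.neg_re, ht, h0]
    simp only [← hc, sub_self, norm_zero]
    nlinarith [sq_nonneg ‖ψ t 0 - c 0‖, sq_nonneg ‖ψ t 1 - c 1‖]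
  have hz : ∀ᶠ t in 𝓝 0, ψ t 0 = c 0 ∧ ψ t 1 = c 1 := by
    filter_upwards [hconst, hHre] with t h1 h2
    have h0 := hHre.self_of_nhds
    have h3 := congrArg norm h1
    rw [Complex.norm_exp, Complex.norm_exp, Real.exp_eq_exp, Complex.neg_re, Complex.neg_re, h2,
      h0] at h3
    simp only [← hc, sub_self, norm_zero] at h3
    have e0 : ‖ψ t 0 - c 0‖ = 0 := by
      nlinarith [sq_nonneg ‖ψ t 0 - c 0‖, sq_nonneg ‖ψ t 1 - c 1‖]
    have e1 : ‖ψ t 1 - c 1‖ = 0 := by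
      nlinarith [sq_nonneg ‖ψ t 0 - c 0‖, sq_nonneg ‖ψ t 1 - c 1‖]
    exact ⟨sub_eq_zero.1 (norm_eq_zero.1 e0), sub_eq_zero.1 (norm_eq_zero.1 e1)⟩
  have d0 : HasDerivAt (fun t => ψ t 0) 0 0 :=
    (hasDerivAt_const 0 (c 0)).congr_of_eventuallyEq (hz.mono fun t ht => ht.1)
  have d1 : HasDerivAt (fun t => ψ t 1) 0 0 :=
    (hasDerivAt_const 0 (c 1)).congr_of_eventuallyEq (hz.mono fun t ht => ht.2)
  have d2 : HasDerivAt (fun t => ψ t 2) 0 0 := by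
    have h2 := (hcomp 2).self_of_nhds.hasDerivAt
    have hH' : HasDerivAt H (-Complex.I * deriv (fun t => ψ t 2) 0) 0 := by
      have := ((h2.const_mul (-Complex.I)).sub (((d0.const_mul (starRingEnd ℂ (c 0))).add
        (d1.const_mul (starRingEnd ℂ (c 1)))).const_mul 2)).add_const
        ((‖c 0‖ ^ 2 + ‖c 1‖ ^ 2 : ℝ) : ℂ)
      exact this.congr_deriv (by simp)
    have h3 := hH'.neg.cexp.unique
      ((hasDerivAt_const 0 (Complex.exp (-H 0))).congr_of_eventuallyEq hconst)
    simp at h3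
    rw [h3] at h2
    exact h2
  refine HasDerivAt.deriv (hasDerivAt_pi.2 fun i => ?_)
  fin_cases i
  exacts [d0, d1, d2]

/-- Transporting a complex line of the indefinite quadric into the definite one gives a nonconstant
holomorphic disc there, against `deriv_eq_zero_of_mem_quadric_one`. -/
theorem not_isBiholomorphicNear_both {M : Set C3} {p : C3} (hp : p ∈ M)
    (h1 : IsBiholomorphicNear M (quadric 1) p) (h2 : IsBiholomorphicNear M (quadric (-1)) p) :
    False := by
  obtain ⟨F, hpF, hF, hFs, hFM⟩ := h1
  obtain ⟨G, hpG, hG, hGs, hGM⟩ := h2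
  set P := G p with hP
  have hPQ : P ∈ quadric (-1) := (hGM hpG).2 hp
  have hPt : P ∈ G.target := G.map_source hpG
  have hGsP : G.symm P = p := G.left_inv hpG
  -- a complex line in the indefinite quadric through `P`
  let d : C3 := ![1, 1, 2 * Complex.I * (starRingEnd ℂ (P 0) - starRingEnd ℂ (P 1))]
  let φ : ℂ → C3 := fun t => P + t • d
  have hφ0 : φ 0 = P := by simp [φ]
  have hφd : ∀ t, HasDerivAt φ d t := fun t =>
    (((hasDerivAt_id t).smul_const d).const_add P).congr_deriv (one_smul _ _)
  have hφQ : ∀ t, φ t ∈ quadric (-1) := by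
    intro t
    have f0 : φ t 0 = P 0 + t * 1 := rfl
    have f1 : φ t 1 = P 1 + t * 1 := rfl
    have f2 : φ t 2 = P 2 +
      t * (2 * Complex.I * (starRingEnd ℂ (P 0) - starRingEnd ℂ (P 1))) := rfl
    simp only [quadric, Set.mem_ofPred_eq, Complex.sq_norm, Complex.normSq_apply] at hPQ ⊢
    rw [f0, f1, f2]
    simp [hPQ]
    ring
  have hφc : ContinuousAt φ 0 := (hφd 0).continuousAt
  have e1 : ∀ᶠ t in 𝓝 0, φ t ∈ G.target :=
    hφc.eventually (by rw [hφ0]; exact G.open_target.mem_nhds hPt)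
  have hcs : ContinuousAt (fun t => G.symm (φ t)) 0 :=
    ContinuousAt.comp' (by rw [hφ0]; exact G.continuousAt_symm hPt) hφc
  have e2 : ∀ᶠ t in 𝓝 0, G.symm (φ t) ∈ F.source :=
    hcs.eventually (by
      beta_reduce
      rw [hφ0, hGsP]
      exact F.open_source.mem_nhds hpF)
  let ψ : ℂ → C3 := fun t => F (G.symm (φ t))
  have hψd : ∀ᶠ t in 𝓝 0, DifferentiableAt ℂ ψ t := by
    filter_upwards [e1, e2] with t h1 h2
    have a1 := hGs.differentiableAt (G.open_target.mem_nhds h1)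
    have a2 := hF.differentiableAt (F.open_source.mem_nhds h2)
    exact a2.comp t (a1.comp t (hφd t).differentiableAt)
  have hψQ : ∀ᶠ t in 𝓝 0, ψ t ∈ quadric 1 := by
    filter_upwards [e1, e2] with t h1 h2
    refine (hFM h2).2 ((hGM (G.map_target h1)).1 ?_)
    rw [G.right_inv h1]
    exact hφQ t
  have hψ' := deriv_eq_zero_of_mem_quadric_one hψd hψQ
  have hψ0 : ψ 0 = F p := by simp only [ψ, hφ0, hGsP]
  -- The line is recovered from its image by a holomorphic map, so zero velocity of `ψ` would force
  -- `d = 0`.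
  have hback : φ =ᶠ[𝓝 0] fun t => G (F.symm (ψ t)) := by
    filter_upwards [e1, e2] with t h1 h2
    simp only [ψ]
    rw [F.left_inv h2, G.right_inv h1]
  have b1 : DifferentiableAt ℂ F.symm (ψ 0) := by
    rw [hψ0]
    exact hFs.differentiableAt (F.open_target.mem_nhds (F.map_source hpF))
  have b2 : DifferentiableAt ℂ G (F.symm (ψ 0)) := by
    rw [hψ0, F.left_inv hpF]
    exact hG.differentiableAt (G.open_source.mem_nhds hpG)
  have hψ1 := hψd.self_of_nhds.hasDerivAt
  rw [hψ'] at hψ1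
  have hD := (b2.comp (ψ 0) b1).hasFDerivAt.comp_hasDerivAt 0 hψ1
  rw [map_zero] at hD
  have hd0 : d = 0 := (hφd 0).unique (hD.congr_of_eventuallyEq hback)
  have := congrFun hd0 0
  simp [d] at this

/-- A connected set which near each of its points is biholomorphic to one of the two quadrics is
spherical. -/
theorem isSpherical_of_isBiholomorphicNear {M : Set C3} (hM : IsConnected M)
    (h : ∀ p ∈ M, IsBiholomorphicNear M (quadric 1) p ∨ IsBiholomorphicNear M (quadric (-1)) p) :
    IsSpherical M := by
  have hopen : ∀ Q : Set C3, IsOpen {p | IsBiholomorphicNear M Q p} := by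
    intro Q
    rw [isOpen_iff_mem_nhds]
    rintro p ⟨F, hp, h1, h2, h3⟩
    filter_upwards [F.open_source.mem_nhds hp] with q hq using ⟨F, hq, h1, h2, h3⟩
  by_contra hcon
  simp only [IsSpherical, not_or] at hcon
  obtain ⟨hc1, hc2⟩ := hcon
  have hex : ∀ Q : Set C3, ¬ IsLocallyBiholomorphicTo M Q →
      ∃ p ∈ M, ¬ IsBiholomorphicNear M Q p := by
    intro Q hQ
    by_contra! h'
    exact hQ h'
  obtain ⟨p, hp, hp'⟩ := hex _ hc1
  obtain ⟨q, hq, hq'⟩ := hex _ hc2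
  -- The points of each type form an open set and the two sets cover $M$; if neither type exhausts
  -- $M$, connectedness yields a point of both.
  obtain ⟨x, hx, hx1, hx2⟩ := hM.isPreconnected _ _ (hopen (quadric 1)) (hopen (quadric (-1))) h
    ⟨q, hq, (h q hq).resolve_right hq'⟩ ⟨p, hp, (h p hp).resolve_left hp'⟩
  exact not_isBiholomorphicNear_both hx hx1 hx2

/-! ### Holomorphic coframes and their differential calculus. -/

/-- The forms `α, β, γ` are the holomorphic coframe on `V` dual to the vector fields `X, Y, Z`. -/
structure IsCoframe (V : Set C3) (X Y Z : C3 → C3) (α β γ : C3 → C3 →L[ℂ] ℂ) : Prop where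
  diffα : DifferentiableOn ℂ α V
  diffβ : DifferentiableOn ℂ β V
  diffγ : DifferentiableOn ℂ γ V
  αX : ∀ q ∈ V, α q (X q) = 1
  αY : ∀ q ∈ V, α q (Y q) = 0
  αZ : ∀ q ∈ V, α q (Z q) = 0
  βX : ∀ q ∈ V, β q (X q) = 0
  βY : ∀ q ∈ V, β q (Y q) = 1
  βZ : ∀ q ∈ V, β q (Z q) = 0
  γX : ∀ q ∈ V, γ q (X q) = 0
  γY : ∀ q ∈ V, γ q (Y q) = 0
  γZ : ∀ q ∈ V, γ q (Z q) = 1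
  expand : ∀ q ∈ V, ∀ v, v = α q v • X q + β q v • Y q + γ q v • Z q

/-- Holomorphic vector fields which are linearly independent at `p` have a dual coframe on a ball
around `p`. -/
theorem exists_isCoframe {U : Set C3} {p : C3} {X Y Z : C3 → C3} (hU : U ∈ 𝓝 p)
    (hX : DifferentiableOn ℂ X U) (hY : DifferentiableOn ℂ Y U) (hZ : DifferentiableOn ℂ Z U)
    (hind : ∀ a b c : ℂ, a • X p + b • Y p + c • Z p = 0 → a = 0 ∧ b = 0 ∧ c = 0) :
    ∃ ε > 0, Metric.ball p ε ⊆ U ∧ ∃ α β γ, IsCoframe (Metric.ball p ε) X Y Z α β γ := by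
  let pr : Fin 3 → C3 →L[ℂ] ℂ := fun i =>
    ContinuousLinearMap.proj (R := ℂ) (φ := fun _ : Fin 3 => ℂ) i
  let S : Fin 3 → C3 →L[ℂ] (C3 →L[ℂ] C3) := fun i =>
    ContinuousLinearMap.smulRightL ℂ C3 C3 (pr i)
  -- The matrix with columns $X,Y,Z$; the rows of its inverse are the coframe.
  let F : C3 → C3 →L[ℂ] C3 := fun q => S 0 (X q) + S 1 (Y q) + S 2 (Z q)
  have hFa : ∀ q c, F q c = c 0 • X q + c 1 • Y q + c 2 • Z q := fun q c => rfl
  have hFd : DifferentiableOn ℂ F U := by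
    have h : ∀ i {T : C3 → C3}, DifferentiableOn ℂ T U → DifferentiableOn ℂ (fun q => S i (T q)) U :=
      fun i T hT => (S i).differentiable.comp_differentiableOn hT
    exact ((h 0 hX).add (h 1 hY)).add (h 2 hZ)
  have hunit : IsUnit (F p) := by
    have hinj : Function.Injective (F p : C3 →ₗ[ℂ] C3) := by
      rw [injective_iff_map_eq_zero]
      intro c hc
      obtain ⟨h0, h1, h2⟩ := hind (c 0) (c 1) (c 2) hc
      ext i
      fin_cases i
      exacts [h0, h1, h2]
    let e : C3 ≃L[ℂ] C3 := (LinearEquiv.ofInjectiveEndo _ hinj).toContinuousLinearEquiv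
    refine ⟨⟨F p, (e.symm : C3 →L[ℂ] C3), ?_, ?_⟩, rfl⟩
    · ext1 v
      exact e.apply_symm_apply v
    · ext1 v
      exact e.symm_apply_apply v
  have hFc : ContinuousAt F p := (hFd.differentiableAt hU).continuousAt
  obtain ⟨ε, hε, hball⟩ := Metric.mem_nhds_iff.1
    (Filter.inter_mem hU (hFc.eventually (Units.isOpen.mem_nhds hunit)))
  have hu : ∀ q ∈ Metric.ball p ε, IsUnit (F q) := fun q hq => (hball hq).2
  have hU' : Metric.ball p ε ⊆ U := fun q hq => (hball hq).1
  have hinvd : DifferentiableOn ℂ (fun q => Ring.inverse (F q)) (Metric.ball p ε) := by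
    intro q hq
    have h1 : DifferentiableAt ℂ F q :=
      (hFd.mono hU').differentiableAt (Metric.isOpen_ball.mem_nhds hq)
    exact ((differentiableAt_inverse (𝕜 := ℂ) (hu q hq)).comp q h1).differentiableWithinAt
  have hl : ∀ q ∈ Metric.ball p ε, ∀ v, Ring.inverse (F q) (F q v) = v := by
    intro q hq v
    have h := Ring.inverse_mul_cancel _ (hu q hq)
    exact DFunLike.congr_fun h v
  have hr : ∀ q ∈ Metric.ball p ε, ∀ v, F q (Ring.inverse (F q) v) = v := by
    intro q hq v
    have h := Ring.mul_inverse_cancel _ (hu q hq)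
    exact DFunLike.congr_fun h v
  have hd : ∀ i, DifferentiableOn ℂ (fun q => (pr i).comp (Ring.inverse (F q)))
      (Metric.ball p ε) := fun i =>
    (ContinuousLinearMap.compL ℂ C3 C3 ℂ (pr i)).differentiable.comp_differentiableOn hinvd
  have hXe : ∀ q ∈ Metric.ball p ε, Ring.inverse (F q) (X q) = ![1, 0, 0] := by
    intro q hq
    rw [← hl q hq ![1, 0, 0], hFa]
    simp
  have hYe : ∀ q ∈ Metric.ball p ε, Ring.inverse (F q) (Y q) = ![0, 1, 0] := by
    intro q hq
    rw [← hl q hq ![0, 1, 0], hFa]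
    simp
  have hZe : ∀ q ∈ Metric.ball p ε, Ring.inverse (F q) (Z q) = ![0, 0, 1] := by
    intro q hq
    rw [← hl q hq ![0, 0, 1], hFa]
    simp
  have hval : ∀ i q v, (pr i).comp (Ring.inverse (F q)) v = Ring.inverse (F q) v i :=
    fun i q v => rfl
  refine ⟨ε, hε, hU', fun q => (pr 0).comp (Ring.inverse (F q)),
    fun q => (pr 1).comp (Ring.inverse (F q)), fun q => (pr 2).comp (Ring.inverse (F q)),
    hd 0, hd 1, hd 2, ?_, ?_, ?_, ?_, ?_, ?_, ?_, ?_, ?_, ?_⟩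
  all_goals intro q hq
  · rw [hval, hXe q hq]; rfl
  · rw [hval, hYe q hq]; rfl
  · rw [hval, hZe q hq]; rfl
  · rw [hval, hXe q hq]; rfl
  · rw [hval, hYe q hq]; rfl
  · rw [hval, hZe q hq]; rfl
  · rw [hval, hXe q hq]; rfl
  · rw [hval, hYe q hq]; rfl
  · rw [hval, hZe q hq]; rfl
  · intro v
    exact (hr q hq v).symm

namespace IsCoframe

variable {V : Set C3} {X Y Z : C3 → C3} {α β γ : C3 → C3 →L[ℂ] ℂ}

theorem coeff_eq (h : IsCoframe V X Y Z α β γ) {q : C3} (hq : q ∈ V) {a b c a' b' c' : ℂ}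
    (e : a • X q + b • Y q + c • Z q = a' • X q + b' • Y q + c' • Z q) :
    a = a' ∧ b = b' ∧ c = c' := by
  have h1 := congrArg (α q) e
  have h2 := congrArg (β q) e
  have h3 := congrArg (γ q) e
  simp only [map_add, map_smul, h.αX q hq, h.αY q hq, h.αZ q hq, h.βX q hq, h.βY q hq, h.βZ q hq,
    h.γX q hq, h.γY q hq, h.γZ q hq, smul_eq_mul, mul_one, mul_zero, add_zero, zero_add] at h1 h2 h3
  exact ⟨h1, h2, h3⟩

theorem apply_eq (h : IsCoframe V X Y Z α β γ) {q : C3} (hq : q ∈ V) (l : C3 →L[ℂ] ℂ) (v : C3) :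
    l v = α q v * l (X q) + β q v * l (Y q) + γ q v * l (Z q) := by
  conv_lhs => rw [h.expand q hq v]
  simp

theorem ext_form (h : IsCoframe V X Y Z α β γ) {q : C3} (hq : q ∈ V) {l m : C3 →L[ℂ] ℂ}
    (hX : l (X q) = m (X q)) (hY : l (Y q) = m (Y q)) (hZ : l (Z q) = m (Z q)) : l = m := by
  ext1 v
  rw [h.apply_eq hq l, h.apply_eq hq m, hX, hY, hZ]

/-- The derivatives of the coefficients of `W` along `T`, from the brackets of `T` with `W` and
with the frame. -/
theorem fderiv_coeff (h : IsCoframe V X Y Z α β γ) (hV : IsOpen V) {T W : C3 → C3} {q : C3}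
    (hq : q ∈ V) (hX : DifferentiableOn ℂ X V) (hY : DifferentiableOn ℂ Y V)
    (hZ : DifferentiableOn ℂ Z V) (hW : DifferentiableOn ℂ W V)
    {x₀ x₁ x₂ y₀ y₁ y₂ z₀ z₁ z₂ w₀ w₁ w₂ : ℂ}
    (hTX : VectorField.lieBracket ℂ T X q = x₀ • X q + x₁ • Y q + x₂ • Z q)
    (hTY : VectorField.lieBracket ℂ T Y q = y₀ • X q + y₁ • Y q + y₂ • Z q)
    (hTZ : VectorField.lieBracket ℂ T Z q = z₀ • X q + z₁ • Y q + z₂ • Z q)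
    (hTW : VectorField.lieBracket ℂ T W q = w₀ • X q + w₁ • Y q + w₂ • Z q) :
    fderiv ℂ (fun q => α q (W q)) q (T q) =
        w₀ - (α q (W q) * x₀ + β q (W q) * y₀ + γ q (W q) * z₀) ∧
      fderiv ℂ (fun q => β q (W q)) q (T q) =
        w₁ - (α q (W q) * x₁ + β q (W q) * y₁ + γ q (W q) * z₁) ∧
      fderiv ℂ (fun q => γ q (W q)) q (T q) =
        w₂ - (α q (W q) * x₂ + β q (W q) * y₂ + γ q (W q) * z₂) := by
  have hn := hV.mem_nhds hq
  have dX := hX.differentiableAt hn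
  have dY := hY.differentiableAt hn
  have dZ := hZ.differentiableAt hn
  have dα := (h.diffα.clm_apply hW).differentiableAt hn
  have dβ := (h.diffβ.clm_apply hW).differentiableAt hn
  have dγ := (h.diffγ.clm_apply hW).differentiableAt hn
  -- Expand $W$ in the frame, use $[T,fX]=(Tf)X+f[T,X]$, and compare coefficients.
  have hWe : W =ᶠ[𝓝 q] ((fun q => α q (W q) • X q) + (fun q => β q (W q) • Y q)) +
      (fun q => γ q (W q) • Z q) := by
    filter_upwards [hn] with y hy using h.expand y hy (W y)
  have hb := (Filter.EventuallyEq.refl (𝓝 q) T).lieBracket_vectorField_eq (𝕜 := ℂ) hWe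
  rw [VectorField.lieBracket_add_right ((dα.fun_smul dX).add (dβ.fun_smul dY)) (dγ.fun_smul dZ),
    VectorField.lieBracket_add_right (dα.fun_smul dX) (dβ.fun_smul dY),
    VectorField.lieBracket_smul_right dα dX, VectorField.lieBracket_smul_right dβ dY,
    VectorField.lieBracket_smul_right dγ dZ, hTX, hTY, hTZ, hTW] at hb
  have hb' : w₀ • X q + w₁ • Y q + w₂ • Z q =
      (fderiv ℂ (fun q => α q (W q)) q (T q) +
        (α q (W q) * x₀ + β q (W q) * y₀ + γ q (W q) * z₀)) • X q +
      (fderiv ℂ (fun q => β q (W q)) q (T q) +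
        (α q (W q) * x₁ + β q (W q) * y₁ + γ q (W q) * z₁)) • Y q +
      (fderiv ℂ (fun q => γ q (W q)) q (T q) +
        (α q (W q) * x₂ + β q (W q) * y₂ + γ q (W q) * z₂)) • Z q := by
    rw [hb]
    module
  obtain ⟨h0, h1, h2⟩ := h.coeff_eq hq hb'
  exact ⟨by rw [h0]; ring, by rw [h1]; ring, by rw [h2]; ring⟩

/-- The last form of the coframe is exact on a convex open set if it vanishes on the brackets of the
frame. -/
theorem exists_primitive (h : IsCoframe V X Y Z α β γ) (hV : IsOpen V) (hVc : Convex ℝ V)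
    (hX : DifferentiableOn ℂ X V) (hY : DifferentiableOn ℂ Y V) (hZ : DifferentiableOn ℂ Z V)
    (hXY : ∀ q ∈ V, γ q (VectorField.lieBracket ℂ X Y q) = 0)
    (hXZ : ∀ q ∈ V, γ q (VectorField.lieBracket ℂ X Z q) = 0)
    (hYZ : ∀ q ∈ V, γ q (VectorField.lieBracket ℂ Y Z q) = 0) :
    ∃ τ : C3 → ℂ, ∀ q ∈ V, HasFDerivAt τ (γ q) q := by
  -- Poincaré lemma on a convex set: it remains to see that $\gamma$ is closed.
  refine hVc.exists_forall_hasFDerivAt_of_fderiv_symmetric hV (h.diffγ.restrictScalars ℝ) ?_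
  intro q hq u v
  have hn := hV.mem_nhds hq
  have dγ := h.diffγ.differentiableAt hn
  rw [dγ.fderiv_restrictScalars ℝ]
  change fderiv ℂ γ q u v = fderiv ℂ γ q v u
  set D := fderiv ℂ γ q with hD
  -- Differentiating the constant $\gamma(T)$ gives $(D_S\gamma)(T)=-\gamma(D_ST)$;
  -- antisymmetrizing, $d\gamma(S,T)=-\gamma([S,T])$ on the frame.
  have hconst : ∀ (S T : C3 → C3) (c : ℂ), DifferentiableOn ℂ T V → (∀ q ∈ V, γ q (T q) = c) →
      D (S q) (T q) = -γ q (fderiv ℂ T q (S q)) := by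
    intro S T c hT hc
    have h1 := dγ.hasFDerivAt.clm_apply (hT.differentiableAt hn).hasFDerivAt
    have h2 : (fun q => γ q (T q)) =ᶠ[𝓝 q] fun _ => c := by
      filter_upwards [hn] with y hy using hc y hy
    have h3 := h1.unique ((hasFDerivAt_const c q).congr_of_eventuallyEq h2)
    have h4 := DFunLike.congr_fun h3 (S q)
    simp at h4
    exact eq_neg_of_add_eq_zero_right h4
  have hsym : ∀ (S T : C3 → C3) (c d : ℂ), DifferentiableOn ℂ S V → DifferentiableOn ℂ T V →
      (∀ q ∈ V, γ q (S q) = c) → (∀ q ∈ V, γ q (T q) = d) →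
      γ q (VectorField.lieBracket ℂ S T q) = 0 → D (S q) (T q) = D (T q) (S q) := by
    intro S T c d hS hT hc hd hb
    rw [hconst S T d hT hd, hconst T S c hS hc]
    rw [VectorField.lieBracket, map_sub, sub_eq_zero] at hb
    rw [hb]
  have e1 := hsym X Y 0 0 hX hY h.γX h.γY (hXY q hq)
  have e2 := hsym X Z 0 1 hX hZ h.γX h.γZ (hXZ q hq)
  have e3 := hsym Y Z 0 1 hY hZ h.γY h.γZ (hYZ q hq)
  rw [h.expand q hq u, h.expand q hq v]
  simp only [map_add, map_smul, add_apply, smul_apply, smul_eq_mul]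
  rw [e1, e2, e3]
  ring

/-- A holomorphic function with `df = c f dτ` that vanishes at one point vanishes identically. -/
theorem eq_zero_of_fderiv (h : IsCoframe V X Y Z α β γ) (hV : IsOpen V) (hVc : IsPreconnected V)
    {f τ : C3 → ℂ} {c : ℂ} {p : C3} (hf : DifferentiableOn ℂ f V)
    (hτ : ∀ q ∈ V, HasFDerivAt τ (γ q) q) (hp : p ∈ V) (hfp : f p = 0)
    (hX : ∀ q ∈ V, fderiv ℂ f q (X q) = 0) (hY : ∀ q ∈ V, fderiv ℂ f q (Y q) = 0)
    (hZ : ∀ q ∈ V, fderiv ℂ f q (Z q) = c * f q) : ∀ q ∈ V, f q = 0 := by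
  -- Integrating factor for $df=cf\,d\tau$.
  have hd : ∀ q ∈ V, HasFDerivAt (fun q => f q * Complex.exp (-c * τ q)) (0 : C3 →L[ℂ] ℂ) q := by
    intro q hq
    have h1 := (hf.differentiableAt (hV.mem_nhds hq)).hasFDerivAt.mul
      ((hτ q hq).const_mul (-c)).cexp
    refine h1.congr_fderiv (h.ext_form hq ?_ ?_ ?_)
    · simp [hX q hq, h.γX q hq]
    · simp [hY q hq, h.γY q hq]
    · simp [hZ q hq, h.γZ q hq]
      ring
  intro q hq
  have hc := hV.is_const_of_fderiv_eq_zero hVc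
    (fun q hq => (hd q hq).differentiableAt.differentiableWithinAt)
    (fun q hq => (hd q hq).fderiv) hq hp
  rw [hfp, zero_mul] at hc
  exact (mul_eq_zero.1 hc).resolve_right (Complex.exp_ne_zero _)

theorem eq_const_of_fderiv (h : IsCoframe V X Y Z α β γ) (hV : IsOpen V) (hVc : IsPreconnected V)
    {f : C3 → ℂ} {p : C3} (hf : DifferentiableOn ℂ f V) (hp : p ∈ V)
    (hX : ∀ q ∈ V, fderiv ℂ f q (X q) = 0) (hY : ∀ q ∈ V, fderiv ℂ f q (Y q) = 0)
    (hZ : ∀ q ∈ V, fderiv ℂ f q (Z q) = 0) : ∀ q ∈ V, f q = f p := fun q hq =>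
  hV.is_const_of_fderiv_eq_zero hVc hf
    (fun q hq => h.ext_form hq (by simp [hX q hq]) (by simp [hY q hq]) (by simp [hZ q hq])) hq hp

end IsCoframe

/-! ### Complexified realizations; coordinates for a locally free nilradical. -/

/-- Five vector fields on `ℂ³`. For a realization of `𝔤_{5,37}` they are the images of
`e₁`, `e₂ + i e₃`, `e₂ - i e₃`, `e₄`, `e₅`. -/
structure FieldTuple where
  (e₁ a b e₄ e₅ : C3 → C3)

namespace FieldTuple

/-- The fields are holomorphic on the open set `U` and satisfy the bracket relations of the
complexification of `𝔤_{5,37}`. -/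
structure IsRealization (F : FieldTuple) (U : Set C3) : Prop where
  isOpen : IsOpen U
  diff₁ : DifferentiableOn ℂ F.e₁ U
  diffa : DifferentiableOn ℂ F.a U
  diffb : DifferentiableOn ℂ F.b U
  diff₄ : DifferentiableOn ℂ F.e₄ U
  diff₅ : DifferentiableOn ℂ F.e₅ U
  lie_1a : ∀ q ∈ U, VectorField.lieBracket ℂ F.e₁ F.a q = 0
  lie_1b : ∀ q ∈ U, VectorField.lieBracket ℂ F.e₁ F.b q = 0
  lie_14 : ∀ q ∈ U, VectorField.lieBracket ℂ F.e₁ F.e₄ q = (2 : ℂ) • F.e₁ q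
  lie_15 : ∀ q ∈ U, VectorField.lieBracket ℂ F.e₁ F.e₅ q = 0
  lie_ab : ∀ q ∈ U, VectorField.lieBracket ℂ F.a F.b q = (-2 * Complex.I) • F.e₁ q
  lie_a4 : ∀ q ∈ U, VectorField.lieBracket ℂ F.a F.e₄ q = F.a q
  lie_a5 : ∀ q ∈ U, VectorField.lieBracket ℂ F.a F.e₅ q = Complex.I • F.a q
  lie_b4 : ∀ q ∈ U, VectorField.lieBracket ℂ F.b F.e₄ q = F.b q
  lie_b5 : ∀ q ∈ U, VectorField.lieBracket ℂ F.b F.e₅ q = (-Complex.I) • F.b q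
  lie_45 : ∀ q ∈ U, VectorField.lieBracket ℂ F.e₄ F.e₅ q = 0

/-- The tuple obtained from the automorphism `e₁ ↦ -e₁`, `e₃ ↦ -e₃`, `e₅ ↦ -e₅`. -/
def swap (F : FieldTuple) : FieldTuple where
  e₁ := (-1 : ℂ) • F.e₁
  a := F.b
  b := F.a
  e₄ := F.e₄
  e₅ := (-1 : ℂ) • F.e₅

/-- The value at `q` of the field with real coordinates `x` in the basis `e₁, …, e₅`. -/
def value (F : FieldTuple) (q : C3) (x : Fin 5 → ℝ) : C3 :=
  -- From $e_2=(a+b)/2$ and $e_3=(a-b)/(2i)$; for real `x` the coefficients of $a$ and $b$ are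
  -- conjugate.
  (x 0 : ℂ) • F.e₁ q + ((x 1 - Complex.I * x 2) / 2) • F.a q +
    ((x 1 + Complex.I * x 2) / 2) • F.b q + (x 3 : ℂ) • F.e₄ q + (x 4 : ℂ) • F.e₅ q

/-- The derivatives of `f` along the five fields at `q`. -/
structure Derivs (F : FieldTuple) (f : C3 → ℂ) (q : C3) (c₁ ca cb c₄ c₅ : ℂ) : Prop where
  d₁ : fderiv ℂ f q (F.e₁ q) = c₁
  da : fderiv ℂ f q (F.a q) = ca
  db : fderiv ℂ f q (F.b q) = cb
  d₄ : fderiv ℂ f q (F.e₄ q) = c₄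
  d₅ : fderiv ℂ f q (F.e₅ q) = c₅

theorem Derivs.value {F : FieldTuple} {f : C3 → ℂ} {q : C3} {c₁ ca cb c₄ c₅ : ℂ}
    (h : F.Derivs f q c₁ ca cb c₄ c₅) (x : Fin 5 → ℝ) :
    fderiv ℂ f q (F.value q x) = x 0 * c₁ + (x 1 - Complex.I * x 2) / 2 * ca +
      (x 1 + Complex.I * x 2) / 2 * cb + x 3 * c₄ + x 4 * c₅ := by
  simp only [FieldTuple.value, map_add, map_smul, smul_eq_mul, h.d₁, h.da, h.db, h.d₄, h.d₅]

variable {F : FieldTuple} {U : Set C3} {p : C3}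

theorem value_swap (F : FieldTuple) (q : C3) (x : Fin 5 → ℝ) :
    F.swap.value q ![-x 0, x 1, -x 2, x 3, -x 4] = F.value q x := by
  simp only [value, swap, Matrix.cons_val_zero, Matrix.cons_val_one, Matrix.cons_val, Pi.smul_apply,
    smul_smul]
  push_cast
  ring_nf

theorem IsRealization.swap (h : F.IsRealization U) : F.swap.IsRealization U := by
  have hd : ∀ {X : C3 → C3}, DifferentiableOn ℂ X U → ∀ q ∈ U, DifferentiableAt ℂ X q :=
    fun hX q hq => hX.differentiableAt (h.isOpen.mem_nhds hq)
  refine ⟨h.isOpen, h.diff₁.const_smul _, h.diffb, h.diffa, h.diff₄, h.diff₅.const_smul _,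
    ?_, ?_, ?_, ?_, ?_, ?_, ?_, ?_, ?_, ?_⟩
  all_goals
    intro q hq
    simp only [FieldTuple.swap]
  · rw [VectorField.lieBracket_const_smul_left (hd h.diff₁ q hq), h.lie_1b q hq, smul_zero]
  · rw [VectorField.lieBracket_const_smul_left (hd h.diff₁ q hq), h.lie_1a q hq, smul_zero]
  · rw [VectorField.lieBracket_const_smul_left (hd h.diff₁ q hq), h.lie_14 q hq, Pi.smul_apply,
      smul_comm]
  · rw [VectorField.lieBracket_const_smul_left (hd h.diff₁ q hq),
      VectorField.lieBracket_const_smul_right (hd h.diff₅ q hq), h.lie_15 q hq, smul_zero, smul_zero]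
  · rw [VectorField.lieBracket_swap, h.lie_ab q hq, Pi.smul_apply, smul_smul, ← neg_smul]
    ring_nf
  · exact h.lie_b4 q hq
  · rw [VectorField.lieBracket_const_smul_right (hd h.diff₅ q hq), h.lie_b5 q hq, smul_smul]
    ring_nf
  · exact h.lie_a4 q hq
  · rw [VectorField.lieBracket_const_smul_right (hd h.diff₅ q hq), h.lie_a5 q hq, smul_smul]
    ring_nf
  · rw [VectorField.lieBracket_const_smul_right (hd h.diff₅ q hq), h.lie_45 q hq, smul_zero]

/-- Coordinates for a realization whose nilradical acts locally freely. -/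
theorem IsRealization.exists_coordinates_of_free (h : F.IsRealization U) (hp : p ∈ U)
    (hind : ∀ x y z : ℂ, x • F.e₁ p + y • F.a p + z • F.b p = 0 → x = 0 ∧ y = 0 ∧ z = 0) :
    ∃ V ∈ 𝓝 p, ∃ t₁ t₂ w : C3 → ℂ, DifferentiableOn ℂ t₁ V ∧ DifferentiableOn ℂ t₂ V ∧
      DifferentiableOn ℂ w V ∧ ∀ q ∈ V,
        F.Derivs t₁ q 0 1 0 (t₁ q) (Complex.I * t₁ q) ∧
        F.Derivs t₂ q 0 0 1 (t₂ q) (-Complex.I * t₂ q) ∧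
        F.Derivs w q 2 (2 * Complex.I * t₂ q) (-2 * Complex.I * t₁ q) (2 * w q) 0 := by
  obtain ⟨ε, hε, hsub, α, β, γ, hc⟩ :=
    exists_isCoframe (h.isOpen.mem_nhds hp) h.diff₁ h.diffa h.diffb hind
  have hV := Metric.isOpen_ball (x := p) (ε := ε)
  have D₁ := h.diff₁.mono hsub
  have Da := h.diffa.mono hsub
  have Db := h.diffb.mono hsub
  have D₄ := h.diff₄.mono hsub
  have D₅ := h.diff₅.mono hsub
  -- The coordinates are the coefficients of $e_4$, which acts on them as an Euler field with
  -- weights $1,1,2$.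
  refine ⟨Metric.ball p ε, Metric.ball_mem_nhds p hε, fun q => β q (F.e₄ q), fun q => γ q (F.e₄ q),
    fun q => α q (F.e₄ q), hc.diffβ.clm_apply D₄, hc.diffγ.clm_apply D₄, hc.diffα.clm_apply D₄,
    fun q hq => ?_⟩
  have hqU := hsub hq
  obtain ⟨w1, s1, t1⟩ := hc.fderiv_coeff hV hq (T := F.e₁) D₁ Da Db D₄
    (x₀ := 0) (x₁ := 0) (x₂ := 0) (y₀ := 0) (y₁ := 0) (y₂ := 0) (z₀ := 0) (z₁ := 0) (z₂ := 0)
    (w₀ := 2) (w₁ := 0) (w₂ := 0) (by simp) (by simp [h.lie_1a q hqU]) (by simp [h.lie_1b q hqU])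
    (by simp [h.lie_14 q hqU])
  obtain ⟨wa, sa, ta⟩ := hc.fderiv_coeff hV hq (T := F.a) D₁ Da Db D₄
    (x₀ := 0) (x₁ := 0) (x₂ := 0) (y₀ := 0) (y₁ := 0) (y₂ := 0) (z₀ := -2 * Complex.I) (z₁ := 0)
    (z₂ := 0) (w₀ := 0) (w₁ := 1) (w₂ := 0)
    (by simp [VectorField.lieBracket_swap (V := F.a), h.lie_1a q hqU]) (by simp)
    (by simp [h.lie_ab q hqU]) (by simp [h.lie_a4 q hqU])
  obtain ⟨wb, sb, tb⟩ := hc.fderiv_coeff hV hq (T := F.b) D₁ Da Db D₄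
    (x₀ := 0) (x₁ := 0) (x₂ := 0) (y₀ := 2 * Complex.I) (y₁ := 0) (y₂ := 0) (z₀ := 0) (z₁ := 0)
    (z₂ := 0) (w₀ := 0) (w₁ := 0) (w₂ := 1)
    (by simp [VectorField.lieBracket_swap (V := F.b), h.lie_1b q hqU])
    (by simp [VectorField.lieBracket_swap (V := F.b) (W := F.a), h.lie_ab q hqU])
    (by simp) (by simp [h.lie_b4 q hqU])
  obtain ⟨u1, v1, r1⟩ := hc.fderiv_coeff hV hq (T := F.e₁) D₁ Da Db D₅
    (x₀ := 0) (x₁ := 0) (x₂ := 0) (y₀ := 0) (y₁ := 0) (y₂ := 0) (z₀ := 0) (z₁ := 0) (z₂ := 0)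
    (w₀ := 0) (w₁ := 0) (w₂ := 0) (by simp) (by simp [h.lie_1a q hqU]) (by simp [h.lie_1b q hqU])
    (by simp [h.lie_15 q hqU])
  obtain ⟨ua, va, ra⟩ := hc.fderiv_coeff hV hq (T := F.a) D₁ Da Db D₅
    (x₀ := 0) (x₁ := 0) (x₂ := 0) (y₀ := 0) (y₁ := 0) (y₂ := 0) (z₀ := -2 * Complex.I) (z₁ := 0)
    (z₂ := 0) (w₀ := 0) (w₁ := Complex.I) (w₂ := 0)
    (by simp [VectorField.lieBracket_swap (V := F.a), h.lie_1a q hqU]) (by simp)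
    (by simp [h.lie_ab q hqU]) (by simp [h.lie_a5 q hqU])
  obtain ⟨ub, vb, rb⟩ := hc.fderiv_coeff hV hq (T := F.b) D₁ Da Db D₅
    (x₀ := 0) (x₁ := 0) (x₂ := 0) (y₀ := 2 * Complex.I) (y₁ := 0) (y₂ := 0) (z₀ := 0) (z₁ := 0)
    (z₂ := 0) (w₀ := 0) (w₁ := 0) (w₂ := -Complex.I)
    (by simp [VectorField.lieBracket_swap (V := F.b), h.lie_1b q hqU])
    (by simp [VectorField.lieBracket_swap (V := F.b) (W := F.a), h.lie_ab q hqU])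
    (by simp) (by simp [h.lie_b5 q hqU])
  obtain ⟨u4, v4, r4⟩ := hc.fderiv_coeff hV hq (T := F.e₄) D₁ Da Db D₅
    (x₀ := -2) (x₁ := 0) (x₂ := 0) (y₀ := 0) (y₁ := -1) (y₂ := 0) (z₀ := 0) (z₁ := 0)
    (z₂ := -1) (w₀ := 0) (w₁ := 0) (w₂ := 0)
    (by simp [VectorField.lieBracket_swap (V := F.e₄), h.lie_14 q hqU])
    (by simp [VectorField.lieBracket_swap (V := F.e₄), h.lie_a4 q hqU])
    (by simp [VectorField.lieBracket_swap (V := F.e₄), h.lie_b4 q hqU])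
    (by simp [h.lie_45 q hqU])
  -- Expanding $e_4$ in the frame turns $[e_4,e_5]=0$ into equations that determine
  -- $e_5=2t_1t_2\,e_1+it_1\,a-it_2\,b$.
  rw [hc.apply_eq hq, u1, ua, ub] at u4
  rw [hc.apply_eq hq, v1, va, vb] at v4
  rw [hc.apply_eq hq, r1, ra, rb] at r4
  have g2 : β q (F.e₅ q) = Complex.I * β q (F.e₄ q) := by linear_combination -v4
  have g3 : γ q (F.e₅ q) = -Complex.I * γ q (F.e₄ q) := by linear_combination -r4
  have g1 : α q (F.e₅ q) = 2 * β q (F.e₄ q) * γ q (F.e₄ q) := by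
    rw [g2, g3] at u4
    linear_combination -u4 / 2 - 2 * β q (F.e₄ q) * γ q (F.e₄ q) * Complex.I_mul_I
  refine ⟨⟨?_, ?_, ?_, ?_, ?_⟩, ⟨?_, ?_, ?_, ?_, ?_⟩, ⟨?_, ?_, ?_, ?_, ?_⟩⟩
  · rw [s1]; ring
  · rw [sa]; ring
  · rw [sb]; ring
  · rw [hc.apply_eq hq, s1, sa, sb]; ring
  · rw [hc.apply_eq hq, s1, sa, sb, g2]; ring
  · rw [t1]; ring
  · rw [ta]; ring
  · rw [tb]; ring
  · rw [hc.apply_eq hq, t1, ta, tb]; ring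
  · rw [hc.apply_eq hq, t1, ta, tb, g3]; ring
  · rw [w1]; ring
  · rw [wa]; ring
  · rw [wb]; ring
  · rw [hc.apply_eq hq, w1, wa, wb]; ring
  · rw [hc.apply_eq hq, w1, wa, wb, g1, g2, g3]
    linear_combination 4 * β q (F.e₄ q) * γ q (F.e₄ q) * Complex.I_mul_I

end FieldTuple

/-! ### Coordinates when the nilradical has two-dimensional complex orbits. -/

namespace FieldTuple

variable {F : FieldTuple} {U : Set C3} {p : C3}

/-- Coordinates for a realization whose nilradical has two-dimensional complex orbits, transversal
to `e₄`. -/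
theorem IsRealization.exists_coordinates_of_transversal₄ (h : F.IsRealization U) (hp : p ∈ U)
    (hind : ∀ x y z : ℂ, x • F.e₁ p + y • F.b p + z • F.e₄ p = 0 → x = 0 ∧ y = 0 ∧ z = 0)
    {k l : ℂ} (ha : F.a p = k • F.e₁ p + l • F.b p) :
    ∃ V ∈ 𝓝 p, ∃ (z w τ : C3 → ℂ) (g : ℂ), DifferentiableOn ℂ z V ∧ DifferentiableOn ℂ w V ∧
      DifferentiableOn ℂ τ V ∧ ∀ q ∈ V,
        F.Derivs z q 0 0 (2 * Complex.I) (z q) (-Complex.I * z q) ∧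
        F.Derivs w q (-2 * g) (-2 * g * z q) 0 (2 * w q) 0 ∧
        F.Derivs τ q 0 0 0 1 g := by
  obtain ⟨ε, hε, hsub, α, β, γ, hc⟩ :=
    exists_isCoframe (h.isOpen.mem_nhds hp) h.diff₁ h.diffb h.diff₄ hind
  have hV := Metric.isOpen_ball (x := p) (ε := ε)
  have hpV := Metric.mem_ball_self (x := p) hε
  have hconn : IsPreconnected (Metric.ball p ε) := (convex_ball p ε).isPreconnected
  have D₁ := h.diff₁.mono hsub
  have Da := h.diffa.mono hsub
  have Db := h.diffb.mono hsub
  have D₄ := h.diff₄.mono hsub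
  have D₅ := h.diff₅.mono hsub
  -- No bracket of $e_1,b,e_4$ has an $e_4$-component, so $\gamma$ is closed.
  obtain ⟨τ, hτ⟩ := hc.exists_primitive hV (convex_ball p ε) D₁ Db D₄
    (fun q hq => by simp [h.lie_1b q (hsub hq)])
    (fun q hq => by simp [h.lie_14 q (hsub hq), hc.γX q hq])
    (fun q hq => by simp [h.lie_b4 q (hsub hq), hc.γY q hq])
  have A1 := fun q hq => hc.fderiv_coeff hV (q := q) hq (T := F.e₁) D₁ Db D₄ Da
    (x₀ := 0) (x₁ := 0) (x₂ := 0) (y₀ := 0) (y₁ := 0) (y₂ := 0) (z₀ := 2) (z₁ := 0) (z₂ := 0)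
    (w₀ := 0) (w₁ := 0) (w₂ := 0) (by simp) (by simp [h.lie_1b q (hsub hq)])
    (by simp [h.lie_14 q (hsub hq)]) (by simp [h.lie_1a q (hsub hq)])
  have Ab := fun q hq => hc.fderiv_coeff hV (q := q) hq (T := F.b) D₁ Db D₄ Da
    (x₀ := 0) (x₁ := 0) (x₂ := 0) (y₀ := 0) (y₁ := 0) (y₂ := 0) (z₀ := 0) (z₁ := 1) (z₂ := 0)
    (w₀ := 2 * Complex.I) (w₁ := 0) (w₂ := 0)
    (by simp [VectorField.lieBracket_swap (V := F.b), h.lie_1b q (hsub hq)]) (by simp)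
    (by simp [h.lie_b4 q (hsub hq)])
    (by simp [VectorField.lieBracket_swap (V := F.b), h.lie_ab q (hsub hq)])
  have A4 := fun q hq => hc.fderiv_coeff hV (q := q) hq (T := F.e₄) D₁ Db D₄ Da
    (x₀ := -2) (x₁ := 0) (x₂ := 0) (y₀ := 0) (y₁ := -1) (y₂ := 0) (z₀ := 0) (z₁ := 0) (z₂ := 0)
    (w₀ := -α q (F.a q)) (w₁ := -β q (F.a q)) (w₂ := -γ q (F.a q))
    (by simp [VectorField.lieBracket_swap (V := F.e₄), h.lie_14 q (hsub hq)])
    (by simp [VectorField.lieBracket_swap (V := F.e₄), h.lie_b4 q (hsub hq)])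
    (by simp)
    (by
      rw [VectorField.lieBracket_swap, h.lie_a4 q (hsub hq)]
      conv_lhs => rw [hc.expand q hq (F.a q)]
      module)
  have A5 := fun q hq => hc.fderiv_coeff hV (q := q) hq (T := F.e₅) D₁ Db D₄ Da
    (x₀ := 0) (x₁ := 0) (x₂ := 0) (y₀ := 0) (y₁ := Complex.I) (y₂ := 0) (z₀ := 0) (z₁ := 0)
    (z₂ := 0) (w₀ := -Complex.I * α q (F.a q)) (w₁ := -Complex.I * β q (F.a q))
    (w₂ := -Complex.I * γ q (F.a q))
    (by simp [VectorField.lieBracket_swap (V := F.e₅), h.lie_15 q (hsub hq)])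
    (by simp [VectorField.lieBracket_swap (V := F.e₅), h.lie_b5 q (hsub hq)])
    (by simp [VectorField.lieBracket_swap (V := F.e₅), h.lie_45 q (hsub hq)])
    (by
      rw [VectorField.lieBracket_swap, h.lie_a5 q (hsub hq)]
      conv_lhs => rw [hc.expand q hq (F.a q)]
      module)
  have B1 := fun q hq => hc.fderiv_coeff hV (q := q) hq (T := F.e₁) D₁ Db D₄ D₅
    (x₀ := 0) (x₁ := 0) (x₂ := 0) (y₀ := 0) (y₁ := 0) (y₂ := 0) (z₀ := 2) (z₁ := 0) (z₂ := 0)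
    (w₀ := 0) (w₁ := 0) (w₂ := 0) (by simp) (by simp [h.lie_1b q (hsub hq)])
    (by simp [h.lie_14 q (hsub hq)]) (by simp [h.lie_15 q (hsub hq)])
  have Bb := fun q hq => hc.fderiv_coeff hV (q := q) hq (T := F.b) D₁ Db D₄ D₅
    (x₀ := 0) (x₁ := 0) (x₂ := 0) (y₀ := 0) (y₁ := 0) (y₂ := 0) (z₀ := 0) (z₁ := 1) (z₂ := 0)
    (w₀ := 0) (w₁ := -Complex.I) (w₂ := 0)
    (by simp [VectorField.lieBracket_swap (V := F.b), h.lie_1b q (hsub hq)]) (by simp)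
    (by simp [h.lie_b4 q (hsub hq)]) (by simp [h.lie_b5 q (hsub hq)])
  have B4 := fun q hq => hc.fderiv_coeff hV (q := q) hq (T := F.e₄) D₁ Db D₄ D₅
    (x₀ := -2) (x₁ := 0) (x₂ := 0) (y₀ := 0) (y₁ := -1) (y₂ := 0) (z₀ := 0) (z₁ := 0) (z₂ := 0)
    (w₀ := 0) (w₁ := 0) (w₂ := 0)
    (by simp [VectorField.lieBracket_swap (V := F.e₄), h.lie_14 q (hsub hq)])
    (by simp [VectorField.lieBracket_swap (V := F.e₄), h.lie_b4 q (hsub hq)])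
    (by simp) (by simp [h.lie_45 q (hsub hq)])
  -- `a` is a multiple of `e₁`
  have hγa : ∀ q ∈ Metric.ball p ε, γ q (F.a q) = 0 :=
    hc.eq_zero_of_fderiv hV hconn (c := -1) (hc.diffγ.clm_apply Da) hτ hpV
      (by rw [ha, map_add, map_smul, map_smul, hc.γX p hpV, hc.γY p hpV]; simp)
      (fun q hq => by rw [(A1 q hq).2.2]; ring) (fun q hq => by rw [(Ab q hq).2.2]; ring)
      (fun q hq => by rw [(A4 q hq).2.2]; ring)
  have hβd : ∀ q ∈ Metric.ball p ε, fderiv ℂ (fun q => β q (F.a q)) q = 0 := fun q hq =>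
    hc.ext_form hq (by rw [(A1 q hq).2.1]; simp) (by rw [(Ab q hq).2.1, hγa q hq]; simp)
      (by rw [(A4 q hq).2.1]; simp)
  -- This coefficient is locally constant, but $a$ and $b$ have opposite weights under $e_5$, which
  -- therefore multiplies it by $-2i$.
  have hβa : ∀ q ∈ Metric.ball p ε, β q (F.a q) = 0 := by
    intro q hq
    have h1 := (A5 q hq).2.1
    rw [hβd q hq, zero_apply] at h1
    have h2 : Complex.I * β q (F.a q) = 0 := by linear_combination h1 / 2
    exact (mul_eq_zero.1 h2).resolve_left Complex.I_ne_zero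
  -- the coefficient of `e₄` in `e₅` is constant
  have hγ5 : ∀ q ∈ Metric.ball p ε, γ q (F.e₅ q) = γ p (F.e₅ p) :=
    hc.eq_const_of_fderiv hV hconn (hc.diffγ.clm_apply D₅) hpV
      (fun q hq => by rw [(B1 q hq).2.2]; ring) (fun q hq => by rw [(Bb q hq).2.2]; ring)
      (fun q hq => by rw [(B4 q hq).2.2]; ring)
  -- Here $a=z\,e_1$, `w` is the $e_1$-coefficient of $e_5$, and `g` is its constant
  -- $e_4$-coefficient.
  refine ⟨Metric.ball p ε, Metric.ball_mem_nhds p hε, fun q => α q (F.a q), fun q => α q (F.e₅ q),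
    τ, γ p (F.e₅ p), hc.diffα.clm_apply Da, hc.diffα.clm_apply D₅,
    fun q hq => (hτ q hq).differentiableAt.differentiableWithinAt, fun q hq => ?_⟩
  have z1 := (A1 q hq).1
  have zb := (Ab q hq).1
  have z4 := (A4 q hq).1
  have z5 := (A5 q hq).1
  have w1 := (B1 q hq).1
  have wb := (Bb q hq).1
  have w4 := (B4 q hq).1
  rw [hγa q hq] at z1 zb z4 z5
  rw [hγ5 q hq] at w1 wb w4
  refine ⟨⟨?_, ?_, ?_, ?_, ?_⟩, ⟨?_, ?_, ?_, ?_, ?_⟩, ⟨?_, ?_, ?_, ?_, ?_⟩⟩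
  · rw [z1]; ring
  · rw [hc.apply_eq hq, z1, hβa q hq, hγa q hq]; ring
  · rw [zb]; ring
  · rw [z4]; ring
  · rw [z5]; ring
  · rw [w1]; ring
  · rw [hc.apply_eq hq, w1, hβa q hq, hγa q hq]; ring
  · rw [wb]; ring
  · rw [w4]; ring
  · rw [hc.apply_eq hq, w1, wb, w4, hγ5 q hq]; ring
  · rw [(hτ q hq).fderiv, hc.γX q hq]
  · rw [(hτ q hq).fderiv, hγa q hq]
  · rw [(hτ q hq).fderiv, hc.γY q hq]
  · rw [(hτ q hq).fderiv, hc.γZ q hq]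
  · rw [(hτ q hq).fderiv, hγ5 q hq]

/-- If at `p` the fields `a` and `e₄` are combinations of `e₁` and `b`, then there is a holomorphic
function whose derivatives along the fields are real constants. -/
theorem IsRealization.exists_function_of_transversal₅ (h : F.IsRealization U) (hp : p ∈ U)
    (hind : ∀ x y z : ℂ, x • F.e₁ p + y • F.b p + z • F.e₅ p = 0 → x = 0 ∧ y = 0 ∧ z = 0)
    {k l k' l' : ℂ} (ha : F.a p = k • F.e₁ p + l • F.b p)
    (h₄ : F.e₄ p = k' • F.e₁ p + l' • F.b p) :
    ∃ V ∈ 𝓝 p, ∃ τ : C3 → ℂ, DifferentiableOn ℂ τ V ∧ ∀ q ∈ V, F.Derivs τ q 0 0 0 0 1 := by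
  obtain ⟨ε, hε, hsub, α, β, γ, hc⟩ :=
    exists_isCoframe (h.isOpen.mem_nhds hp) h.diff₁ h.diffb h.diff₅ hind
  have hV := Metric.isOpen_ball (x := p) (ε := ε)
  have hpV := Metric.mem_ball_self (x := p) hε
  have hconn : IsPreconnected (Metric.ball p ε) := (convex_ball p ε).isPreconnected
  have D₁ := h.diff₁.mono hsub
  have Da := h.diffa.mono hsub
  have Db := h.diffb.mono hsub
  have D₄ := h.diff₄.mono hsub
  have D₅ := h.diff₅.mono hsub
  obtain ⟨τ, hτ⟩ := hc.exists_primitive hV (convex_ball p ε) D₁ Db D₅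
    (fun q hq => by simp [h.lie_1b q (hsub hq)])
    (fun q hq => by simp [h.lie_15 q (hsub hq)])
    (fun q hq => by simp [h.lie_b5 q (hsub hq), hc.γY q hq])
  have hb1 : ∀ q ∈ Metric.ball p ε, VectorField.lieBracket ℂ F.b F.e₁ q = 0 := fun q hq => by
    simp [VectorField.lieBracket_swap (V := F.b), h.lie_1b q (hsub hq)]
  have h51 : ∀ q ∈ Metric.ball p ε, VectorField.lieBracket ℂ F.e₅ F.e₁ q = 0 := fun q hq => by
    simp [VectorField.lieBracket_swap (V := F.e₅), h.lie_15 q (hsub hq)]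
  have h5b : ∀ q ∈ Metric.ball p ε, VectorField.lieBracket ℂ F.e₅ F.b q = Complex.I • F.b q :=
    fun q hq => by simp [VectorField.lieBracket_swap (V := F.e₅), h.lie_b5 q (hsub hq)]
  have A1 := fun q hq => (hc.fderiv_coeff hV (q := q) hq (T := F.e₁) D₁ Db D₅ Da
    (x₀ := 0) (x₁ := 0) (x₂ := 0) (y₀ := 0) (y₁ := 0) (y₂ := 0) (z₀ := 0) (z₁ := 0) (z₂ := 0)
    (w₀ := 0) (w₁ := 0) (w₂ := 0) (by simp) (by simp [h.lie_1b q (hsub hq)])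
    (by simp [h.lie_15 q (hsub hq)]) (by simp [h.lie_1a q (hsub hq)])).2.2
  have Ab := fun q hq => (hc.fderiv_coeff hV (q := q) hq (T := F.b) D₁ Db D₅ Da
    (x₀ := 0) (x₁ := 0) (x₂ := 0) (y₀ := 0) (y₁ := 0) (y₂ := 0) (z₀ := 0) (z₁ := -Complex.I)
    (z₂ := 0) (w₀ := 2 * Complex.I) (w₁ := 0) (w₂ := 0)
    (by simp [hb1 q hq]) (by simp) (by simp [h.lie_b5 q (hsub hq)])
    (by simp [VectorField.lieBracket_swap (V := F.b), h.lie_ab q (hsub hq)])).2.2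
  have A5 := fun q hq => (hc.fderiv_coeff hV (q := q) hq (T := F.e₅) D₁ Db D₅ Da
    (x₀ := 0) (x₁ := 0) (x₂ := 0) (y₀ := 0) (y₁ := Complex.I) (y₂ := 0) (z₀ := 0) (z₁ := 0)
    (z₂ := 0) (w₀ := -Complex.I * α q (F.a q)) (w₁ := -Complex.I * β q (F.a q))
    (w₂ := -Complex.I * γ q (F.a q)) (by simp [h51 q hq]) (by simp [h5b q hq]) (by simp)
    (by
      rw [VectorField.lieBracket_swap, h.lie_a5 q (hsub hq)]
      conv_lhs => rw [hc.expand q hq (F.a q)]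
      module)).2.2
  have B1 := fun q hq => (hc.fderiv_coeff hV (q := q) hq (T := F.e₁) D₁ Db D₅ D₄
    (x₀ := 0) (x₁ := 0) (x₂ := 0) (y₀ := 0) (y₁ := 0) (y₂ := 0) (z₀ := 0) (z₁ := 0) (z₂ := 0)
    (w₀ := 2) (w₁ := 0) (w₂ := 0) (by simp) (by simp [h.lie_1b q (hsub hq)])
    (by simp [h.lie_15 q (hsub hq)]) (by simp [h.lie_14 q (hsub hq)])).2.2
  have Bb := fun q hq => (hc.fderiv_coeff hV (q := q) hq (T := F.b) D₁ Db D₅ D₄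
    (x₀ := 0) (x₁ := 0) (x₂ := 0) (y₀ := 0) (y₁ := 0) (y₂ := 0) (z₀ := 0) (z₁ := -Complex.I)
    (z₂ := 0) (w₀ := 0) (w₁ := 1) (w₂ := 0)
    (by simp [hb1 q hq]) (by simp) (by simp [h.lie_b5 q (hsub hq)])
    (by simp [h.lie_b4 q (hsub hq)])).2.2
  have B5 := fun q hq => (hc.fderiv_coeff hV (q := q) hq (T := F.e₅) D₁ Db D₅ D₄
    (x₀ := 0) (x₁ := 0) (x₂ := 0) (y₀ := 0) (y₁ := Complex.I) (y₂ := 0) (z₀ := 0) (z₁ := 0)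
    (z₂ := 0) (w₀ := 0) (w₁ := 0) (w₂ := 0) (by simp [h51 q hq]) (by simp [h5b q hq]) (by simp)
    (by simp [VectorField.lieBracket_swap (V := F.e₅), h.lie_45 q (hsub hq)])).2.2
  have hγa : ∀ q ∈ Metric.ball p ε, γ q (F.a q) = 0 :=
    hc.eq_zero_of_fderiv hV hconn (c := -Complex.I) (hc.diffγ.clm_apply Da) hτ hpV
      (by rw [ha, map_add, map_smul, map_smul, hc.γX p hpV, hc.γY p hpV]; simp)
      (fun q hq => by rw [A1 q hq]; ring) (fun q hq => by rw [Ab q hq]; ring)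
      (fun q hq => by rw [A5 q hq]; ring)
  have hγ4 : ∀ q ∈ Metric.ball p ε, γ q (F.e₄ q) = 0 :=
    hc.eq_zero_of_fderiv hV hconn (c := 0) (hc.diffγ.clm_apply D₄) hτ hpV
      (by rw [h₄, map_add, map_smul, map_smul, hc.γX p hpV, hc.γY p hpV]; simp)
      (fun q hq => by rw [B1 q hq]; ring) (fun q hq => by rw [Bb q hq]; ring)
      (fun q hq => by rw [B5 q hq]; ring)
  refine ⟨Metric.ball p ε, Metric.ball_mem_nhds p hε, τ,
    fun q hq => (hτ q hq).differentiableAt.differentiableWithinAt, fun q hq => ?_⟩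
  refine ⟨?_, ?_, ?_, ?_, ?_⟩
  · rw [(hτ q hq).fderiv, hc.γX q hq]
  · rw [(hτ q hq).fderiv, hγa q hq]
  · rw [(hτ q hq).fderiv, hc.γY q hq]
  · rw [(hτ q hq).fderiv, hγ4 q hq]
  · rw [(hτ q hq).fderiv, hc.γZ q hq]

end FieldTuple

/-! ### Local form of the orbit in the adapted coordinates. -/

/-- A real-linear map onto `ℂ` does not vanish on a real hyperplane. -/
theorem false_of_ker_le {l : C3 →L[ℝ] ℝ} {σ : C3 →L[ℝ] ℂ} (hσ : Function.Surjective σ)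
    (h : ∀ v, l v = 0 → σ v = 0) : False := by
  obtain ⟨u, hu⟩ := hσ 1
  obtain ⟨v, hv⟩ := hσ Complex.I
  have h1 := h (l v • u - l u • v) (by simp [mul_comm])
  rw [map_sub, map_smul, map_smul, hu, hv] at h1
  have h2 : l u = 0 := by simpa using congrArg Complex.im h1
  exact one_ne_zero (hu.symm.trans (h u h2))

namespace FieldTuple

variable {F : FieldTuple} {U M : Set C3} {p : C3} {Φ : C3 → ℝ}

/-- Near `p`, the tangent vectors of the hypersurface `M` are values of real combinations of the
fields. -/
structure IsTangentNear (F : FieldTuple) (M : Set C3) (p : C3) (Φ : C3 → ℝ) : Prop where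
  mem : p ∈ M
  defining : IsDefiningFunctionAt M p Φ
  tangent : ∀ᶠ q in 𝓝 p, q ∈ M → ∀ v, fderiv ℝ Φ q v = 0 → ∃ x, v = F.value q x
  e₁_ne : F.e₁ p ≠ 0

theorem IsTangentNear.swap (h : F.IsTangentNear M p Φ) : F.swap.IsTangentNear M p Φ := by
  refine ⟨h.mem, h.defining, ?_, ?_⟩
  · filter_upwards [h.tangent] with q hq hM v hv
    obtain ⟨x, rfl⟩ := hq hM v hv
    exact ⟨_, (F.value_swap q x).symm⟩
  · simpa [FieldTuple.swap] using h.e₁_ne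

/-- A hypersurface on which the fields preserve the level sets of the imaginary part of a
holomorphic function is not Levi-nondegenerate. -/
theorem IsTangentNear.false_of_real_derivs (h : F.IsTangentNear M p Φ)
    (hLevi : IsLeviNondegenerate M) {V : Set C3} {τ : C3 → ℂ} {c₄ c₅ : ℝ} (hV : V ∈ 𝓝 p)
    (hτ : DifferentiableOn ℂ τ V) (hd : ∀ q ∈ V, F.Derivs τ q 0 0 0 c₄ c₅)
    (hne : c₄ ≠ 0 ∨ c₅ ≠ 0) : False := by
  have hτa := hτ.analyticAt_C3 hV
  have hp := hd p (mem_of_mem_nhds hV)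
  obtain ⟨v, c, hc, hv⟩ : ∃ v, ∃ c : ℝ, c ≠ 0 ∧ fderiv ℂ τ p v = c := by
    rcases hne with hc | hc
    exacts [⟨_, _, hc, hp.d₄⟩, ⟨_, _, hc, hp.d₅⟩]
  have hM := h.defining.eventually_mem_iff_level (I := fun q => (τ q).im) h.mem
    hτa.im_real.contDiffAt ?_ ?_
  · have hW : AnalyticAt ℂ (fun q => τ q - τ p) p := hτa.sub analyticAt_const
    have hWd : fderiv ℂ (fun q => τ q - τ p) p = fderiv ℂ τ p := fderiv_sub_const _
    -- Near $p$ the hypersurface is a level set of $\operatorname{Im}\tau$, hence Levi-flat, and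
    -- $e_1$ is a nonzero vector annihilated by $d\tau$.
    refine h.e₁_ne (hLevi.eq_zero_of_stationary (p := p) (ξ := F.e₁ p) (v := v)
      (W := fun q => τ q - τ p) (Z₁ := 0) (Z₂ := 0) (κ₁ := 0) (κ₂ := 0) h.mem analyticAt_const
      analyticAt_const hW ?_ ?_ (.inl rfl) (.inl rfl) ?_ (.inl rfl) (.inl rfl))
    · filter_upwards [hM] with q hq
      rw [hq]
      simp [sub_eq_zero]
    · rw [hWd, hv]
      exact_mod_cast hc
    · rw [hWd, hp.d₁]
  · intro h0
    have h1 := DFunLike.congr_fun h0 (Complex.I • v)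
    rw [hτa.eventually_hasFDerivAt_real.self_of_nhds.im_real.fderiv] at h1
    simp [hv, hc] at h1
  · filter_upwards [h.tangent, hτa.eventually_hasFDerivAt_real, hV] with q h1 h2 hq hqM v hv
    obtain ⟨x, rfl⟩ := h1 hqM v hv
    rw [h2.im_real.fderiv]
    simp [(hd q hq).value]

theorem IsTangentNear.isBiholomorphicNear_of_free (h : F.IsTangentNear M p Φ)
    (hF : F.IsRealization U) (hpU : p ∈ U) (hLevi : IsLeviNondegenerate M)
    (hind : ∀ x y z : ℂ, x • F.e₁ p + y • F.a p + z • F.b p = 0 → x = 0 ∧ y = 0 ∧ z = 0) :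
    IsBiholomorphicNear M (quadric 1) p ∨ IsBiholomorphicNear M (quadric (-1)) p := by
  obtain ⟨V, hV, t₁, t₂, w, D₁, D₂, Dw, hd⟩ := hF.exists_coordinates_of_free hpU hind
  have A₁ := D₁.analyticAt_C3 hV
  have A₂ := D₂.analyticAt_C3 hV
  have Aw := Dw.analyticAt_C3 hV
  obtain ⟨p₁, p₂, pw⟩ := hd p (mem_of_mem_nhds hV)
  -- For real combinations $x$ the translation parts of $t_1$ and $\bar t_2$ coincide, so $\sigma$
  -- is only multiplied by $x_3+ix_4$.
  let σ : C3 → ℂ := fun q => t₁ q - starRingEnd ℂ (t₂ q)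
  let σ' : C3 → C3 →L[ℝ] ℂ := fun q => (fderiv ℂ t₁ q).restrictScalars ℝ -
    (Complex.conjCLE : ℂ →L[ℝ] ℂ).comp ((fderiv ℂ t₂ q).restrictScalars ℝ)
  have hσ' : ∀ q v, σ' q v = fderiv ℂ t₁ q v - starRingEnd ℂ (fderiv ℂ t₂ q v) := fun q v => rfl
  have hσ : ∀ᶠ q in 𝓝 p, HasFDerivAt σ (σ' q) q := by
    filter_upwards [A₁.eventually_hasFDerivAt_real, A₂.eventually_hasFDerivAt_real] with q h1 h2
    exact h1.sub ((Complex.conjCLE : ℂ →L[ℝ] ℂ).hasFDerivAt.comp q h2)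
  have hσv : ∀ q ∈ V, ∀ x, σ' q (F.value q x) = x 3 * σ q + x 4 * Complex.I * σ q := by
    intro q hq x
    rw [hσ', (hd q hq).1.value, (hd q hq).2.1.value]
    have h2 : starRingEnd ℂ 2 = 2 := map_ofNat _ 2
    simp [σ, h2]
    ring
  -- If $\sigma(p)=0$, then $d\sigma$, which maps onto $\mathbb C$, would vanish on the real tangent
  -- hyperplane.
  have hσ0 : σ p ≠ 0 := by
    intro h0
    refine false_of_ker_le (l := fderiv ℝ Φ p) (σ := σ' p) ?_ ?_
    · intro c
      refine ⟨c • F.a p, ?_⟩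
      rw [hσ']
      simp [p₁.da, p₂.da]
    · intro v hv
      obtain ⟨x, rfl⟩ := h.tangent.self_of_nhds h.mem v hv
      rw [hσv p (mem_of_mem_nhds hV), h0]
      simp
  let r : C3 → ℝ := fun q => (w q).im + (‖t₁ q‖ ^ 2 - ‖t₂ q‖ ^ 2)
  let s : C3 → ℝ := fun q => ‖σ q‖ ^ 2
  have hr : AnalyticAt ℝ r p := Aw.im_real.add (A₁.norm_sq_real.sub A₂.norm_sq_real)
  have hs : AnalyticAt ℝ s p := by
    have hσa : AnalyticAt ℝ σ p := (A₁.restrictScalars (𝕜 := ℝ)).sub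
      (((Complex.conjCLE : ℂ →L[ℝ] ℂ).analyticAt _).comp (A₂.restrictScalars (𝕜 := ℝ)))
    have hre : AnalyticAt ℝ (fun q => (σ q).re) p := (Complex.reCLM.analyticAt _).comp hσa
    have him : AnalyticAt ℝ (fun q => (σ q).im) p := (Complex.imCLM.analyticAt _).comp hσa
    simp only [s, Complex.sq_norm, Complex.normSq_apply]
    exact (hre.mul hre).add (him.mul him)
  have hrd : ∀ᶠ q in 𝓝 p, ∀ v, fderiv ℝ r q v = (fderiv ℂ w q v).im +
      (2 * ((t₁ q).re * (fderiv ℂ t₁ q v).re + (t₁ q).im * (fderiv ℂ t₁ q v).im) -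
        2 * ((t₂ q).re * (fderiv ℂ t₂ q v).re + (t₂ q).im * (fderiv ℂ t₂ q v).im)) := by
    filter_upwards [A₁.eventually_hasFDerivAt_real, A₂.eventually_hasFDerivAt_real,
      Aw.eventually_hasFDerivAt_real, A₁.norm_sq_real.eventually_analyticAt,
      A₂.norm_sq_real.eventually_analyticAt] with q h1 h2 h3 h4 h5 v
    have h6 : HasFDerivAt r _ q := h3.im_real.add
      (h4.differentiableAt.hasFDerivAt.sub h5.differentiableAt.hasFDerivAt)
    rw [h6.fderiv]
    simp only [add_apply, sub_apply, fderiv_norm_sq_real h1, fderiv_norm_sq_real h2]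
    rfl
  obtain ⟨c, hM⟩ : ∃ c : ℝ, ∀ᶠ q in 𝓝 p, q ∈ M ↔ r q = c * s q := by
    refine h.defining.exists_eventually_mem_iff (ξ := Complex.I • F.e₁ p) (r := r)
      (s := s) h.mem hr.contDiffAt hs.contDiffAt (by simp [s, hσ0]) ?_ ?_ ?_
    · rw [hrd.self_of_nhds]
      simp [p₁.d₁, p₂.d₁, pw.d₁]
    · rw [fderiv_norm_sq_real hσ.self_of_nhds, hσ']
      simp [p₁.d₁, p₂.d₁]
    · filter_upwards [h.tangent, hσ, hrd, hV] with q h1 h2 h3 hq hqM v hv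
      obtain ⟨x, rfl⟩ := h1 hqM v hv
      refine ⟨2 * x 3, ?_, ?_⟩
      · rw [h3, (hd q hq).1.value, (hd q hq).2.1.value, (hd q hq).2.2.value]
        simp [r, Complex.sq_norm, Complex.normSq_apply]
        ring
      · rw [fderiv_norm_sq_real h2, hσv q hq]
        simp [s, Complex.sq_norm, Complex.normSq_apply]
        ring
  -- In $|\sigma|^2=|t_1|^2+|t_2|^2-2\operatorname{Re}(t_1t_2)$ the last term is pluriharmonic and
  -- moves into $W$; the squares combine with those of $r$ to give $c\mp1$.
  refine hLevi.isBiholomorphicNear_quadric (Z₁ := t₁) (Z₂ := t₂)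
    (W := fun q => w q + 2 * Complex.I * c * (t₁ q * t₂ q)) (κ₁ := c - 1) (κ₂ := c + 1)
    h.mem A₁ A₂ (Aw.add (analyticAt_const.mul (A₁.mul A₂))) ?_ ?_
  · filter_upwards [hM] with q hq
    rw [hq]
    simp only [r, s, σ, Complex.sq_norm, Complex.normSq_apply]
    simp
    constructor <;> intro h <;> linarith
  · intro x y z
    have hW : HasFDerivAt (fun q => w q + 2 * Complex.I * c * (t₁ q * t₂ q)) _ p :=
      Aw.differentiableAt.hasFDerivAt.add ((A₁.differentiableAt.hasFDerivAt.mul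
        A₂.differentiableAt.hasFDerivAt).const_mul (2 * Complex.I * c))
    refine ⟨((z - (2 * Complex.I * t₂ p * x - 2 * Complex.I * t₁ p * y) -
      2 * Complex.I * c * (t₁ p * y + t₂ p * x)) / 2) • F.e₁ p + x • F.a p + y • F.b p, ?_, ?_, ?_⟩
    · simp [p₁.d₁, p₁.da, p₁.db]
    · simp [p₂.d₁, p₂.da, p₂.db]
    · rw [hW.fderiv]
      simp [p₁.d₁, p₁.da, p₁.db, p₂.d₁, p₂.da, p₂.db, pw.d₁, pw.da, pw.db]
      ring

theorem IsTangentNear.isBiholomorphicNear_of_transversal₄ (h : F.IsTangentNear M p Φ)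
    (hF : F.IsRealization U) (hpU : p ∈ U) (hLevi : IsLeviNondegenerate M)
    (hind : ∀ x y z : ℂ, x • F.e₁ p + y • F.b p + z • F.e₄ p = 0 → x = 0 ∧ y = 0 ∧ z = 0)
    {k l : ℂ} (ha : F.a p = k • F.e₁ p + l • F.b p) :
    IsBiholomorphicNear M (quadric 1) p ∨ IsBiholomorphicNear M (quadric (-1)) p := by
  obtain ⟨V, hV, z, w, τ, g, Dz, Dw, Dτ, hd⟩ := hF.exists_coordinates_of_transversal₄ hpU hind ha
  -- For real $g$ all derivatives of $\tau$ along the fields are real, which is the excluded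
  -- Levi-flat case.
  by_cases hg : g.im = 0
  · have hg' : g = (g.re : ℂ) := Complex.ext rfl (by simp [hg])
    refine (h.false_of_real_derivs hLevi (c₄ := 1) (c₅ := g.re) hV Dτ (fun q hq => ?_)
      (.inl one_ne_zero)).elim
    rw [← hg', Complex.ofReal_one]
    exact (hd q hq).2.2
  have hg0 : g ≠ 0 := by
    rintro rfl
    exact hg rfl
  have Az := Dz.analyticAt_C3 hV
  let W : C3 → ℂ := fun q => (-2 * g)⁻¹ * w q
  -- Chosen so that $\operatorname{Re}m=1$ and $\operatorname{Re}(mg)=0$: then $|e^{m\tau}|^2$ has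
  -- weight 2 under $e_4$ and is invariant under $e_5$, exactly like `r` below.
  let m : ℂ := ⟨1, g.re / g.im⟩
  have hm0 : m ≠ 0 := fun h0 => one_ne_zero (congrArg Complex.re h0)
  have hmg : (m * g).re = 0 := by
    simp [m]
    field_simp
    ring
  let ζ : C3 → ℂ := fun q => Complex.exp (m * τ q)
  have AW : AnalyticAt ℂ W p := analyticAt_const.mul (Dw.analyticAt_C3 hV)
  have Aζ : AnalyticAt ℂ ζ p := (analyticAt_const.mul (Dτ.analyticAt_C3 hV)).cexp
  have hVo : ∀ᶠ q in 𝓝 p, V ∈ 𝓝 q := eventually_mem_nhds_iff.2 hV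
  have hdW : ∀ᶠ q in 𝓝 p, F.Derivs W q 1 (z q) 0 (2 * W q) 0 := by
    filter_upwards [hVo] with q hqV
    have hq := (hd q (mem_of_mem_nhds hqV)).2.1
    have e : fderiv ℂ W q = (-2 * g)⁻¹ • fderiv ℂ w q :=
      ((Dw.differentiableAt hqV).hasFDerivAt.const_mul _).fderiv
    constructor <;> rw [e] <;> simp only [smul_apply, smul_eq_mul, W]
    · rw [hq.d₁]; field_simp
    · rw [hq.da]; field_simp
    · rw [hq.db]; ring
    · rw [hq.d₄]; ring
    · rw [hq.d₅]; ring
  have hdζ : ∀ᶠ q in 𝓝 p, F.Derivs ζ q 0 0 0 (m * ζ q) (m * g * ζ q) := by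
    filter_upwards [hVo] with q hqV
    have hq := (hd q (mem_of_mem_nhds hqV)).2.2
    have e : fderiv ℂ ζ q = ζ q • (m • fderiv ℂ τ q) :=
      ((Dτ.differentiableAt hqV).hasFDerivAt.const_mul m).cexp.fderiv
    constructor <;> rw [e] <;> simp only [smul_apply, smul_eq_mul]
    · rw [hq.d₁]; ring
    · rw [hq.da]; ring
    · rw [hq.db]; ring
    · rw [hq.d₄]; ring
    · rw [hq.d₅]; ring
  have pz := (hd p (mem_of_mem_nhds hV)).1
  have pW := hdW.self_of_nhds
  have pζ := hdζ.self_of_nhds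
  let r : C3 → ℝ := fun q => (W q).im - 4⁻¹ * ‖z q‖ ^ 2
  have hr : AnalyticAt ℝ r p := AW.im_real.sub (analyticAt_const.mul Az.norm_sq_real)
  have hrd : ∀ᶠ q in 𝓝 p, ∀ v, fderiv ℝ r q v = (fderiv ℂ W q v).im -
      4⁻¹ * (2 * ((z q).re * (fderiv ℂ z q v).re + (z q).im * (fderiv ℂ z q v).im)) := by
    filter_upwards [Az.eventually_hasFDerivAt_real, AW.eventually_hasFDerivAt_real,
      Az.norm_sq_real.eventually_analyticAt] with q h1 h2 h3 v
    have h6 : HasFDerivAt r _ q := h2.im_real.sub (h3.differentiableAt.hasFDerivAt.const_mul 4⁻¹)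
    rw [h6.fderiv]
    simp only [sub_apply, smul_apply, fderiv_norm_sq_real h1]
    rfl
  obtain ⟨c, hM⟩ : ∃ c : ℝ, ∀ᶠ q in 𝓝 p, q ∈ M ↔ r q = c * ‖ζ q‖ ^ 2 := by
    refine h.defining.exists_eventually_mem_iff (ξ := Complex.I • F.e₁ p) (r := r)
      (s := fun q => ‖ζ q‖ ^ 2) h.mem hr.contDiffAt Aζ.norm_sq_real.contDiffAt
      (by simp [ζ, Complex.exp_ne_zero]) ?_ ?_ ?_
    · rw [hrd.self_of_nhds]
      simp [pz.d₁, pW.d₁]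
    · rw [fderiv_norm_sq_real Aζ.eventually_hasFDerivAt_real.self_of_nhds]
      simp [pζ.d₁]
    · filter_upwards [h.tangent, hrd, hdW, hdζ, Aζ.eventually_hasFDerivAt_real, hV]
        with q h1 h2 h3 h4 h5 hq hqM v hv
      obtain ⟨x, rfl⟩ := h1 hqM v hv
      refine ⟨2 * x 3, ?_, ?_⟩
      · rw [h2, (hd q hq).1.value, h3.value]
        simp [r, Complex.sq_norm, Complex.normSq_apply]
        ring
      · rw [fderiv_norm_sq_real h5, ContinuousLinearMap.coe_restrictScalars', h4.value]
        have hm1 : m.re = 1 := rfl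
        simp only [Complex.mul_re] at hmg
        simp [Complex.sq_norm, Complex.normSq_apply, hm1] at hmg ⊢
        linear_combination 2 * x 4 * ((ζ q).re ^ 2 + (ζ q).im ^ 2) * hmg
  refine hLevi.isBiholomorphicNear_quadric (Z₁ := z) (Z₂ := ζ) (W := W) (κ₁ := 4⁻¹) (κ₂ := c)
    h.mem Az Aζ AW ?_ ?_
  · filter_upwards [hM] with q hq
    rw [hq]
    simp only [r]
    constructor <;> intro h <;> linarith
  · intro x y t
    have hζ0 : ζ p ≠ 0 := Complex.exp_ne_zero _
    refine ⟨(t - 2 * W p * (y / (m * ζ p))) • F.e₁ p +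
      ((x - z p * (y / (m * ζ p))) / (2 * Complex.I)) • F.b p + (y / (m * ζ p)) • F.e₄ p,
      ?_, ?_, ?_⟩
    · simp only [map_add, map_smul, smul_eq_mul, pz.d₁, pz.db, pz.d₄]
      rw [div_mul_cancel₀ _ (by simp)]
      ring
    · simp only [map_add, map_smul, smul_eq_mul, pζ.d₁, pζ.db, pζ.d₄]
      rw [div_mul_cancel₀ _ (mul_ne_zero hm0 hζ0)]
      ring
    · simp only [map_add, map_smul, smul_eq_mul, pW.d₁, pW.db, pW.d₄]
      ring

end FieldTuple

/-! ### Case distinction on the values of the fields at a point. -/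

namespace FieldTuple

variable {F : FieldTuple} {U M : Set C3} {p : C3} {Φ : C3 → ℝ}

/-- A vector is a combination of two independent vectors if the three are dependent. -/
theorem exists_eq_combination {u v t : C3} (hind : ∀ x y : ℂ, x • u + y • v = 0 → x = 0 ∧ y = 0)
    (h : ¬ ∀ x y z : ℂ, x • u + y • v + z • t = 0 → x = 0 ∧ y = 0 ∧ z = 0) :
    ∃ k l : ℂ, t = k • u + l • v := by
  push Not at h
  obtain ⟨x, y, z, h1, h2⟩ := h
  have hz : z ≠ 0 := by
    rintro rfl
    obtain ⟨hx, hy⟩ := hind x y (by simpa using h1)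
    exact h2 hx hy rfl
  refine ⟨-x / z, -y / z, ?_⟩
  have h3 : z • t = -(x • u + y • v) := eq_neg_of_add_eq_zero_right h1
  have h4 : t = z⁻¹ • (z • t) := by rw [smul_smul, inv_mul_cancel₀ hz, one_smul]
  rw [h4, h3]
  module

/-- The values of the fields at a point of the hypersurface span `ℂ³`. -/
theorem IsTangentNear.not_mem_plane (h : F.IsTangentNear M p Φ) {u v : C3}
    (h₁ : ∃ k l : ℂ, F.e₁ p = k • u + l • v) (ha : ∃ k l : ℂ, F.a p = k • u + l • v)
    (hb : ∃ k l : ℂ, F.b p = k • u + l • v) (h₄ : ∃ k l : ℂ, F.e₄ p = k • u + l • v)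
    (h₅ : ∃ k l : ℂ, F.e₅ p = k • u + l • v) : False := by
  let P : Submodule ℂ C3 := Submodule.span ℂ (Set.range ![u, v])
  have hP : P < ⊤ := by
    refine lt_of_le_of_ne le_top fun hP => ?_
    have h1 := finrank_range_le_card (R := ℂ) ![u, v]
    rw [Set.finrank] at h1
    change Module.finrank ℂ P ≤ _ at h1
    rw [hP, finrank_top] at h1
    simp at h1
  obtain ⟨f, hf0, hf⟩ := Submodule.exists_le_ker_of_lt_top P hP
  have hu : f u = 0 := hf (Submodule.subset_span ⟨0, rfl⟩)
  have hv : f v = 0 := hf (Submodule.subset_span ⟨1, rfl⟩)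
  have hz : ∀ t : C3, (∃ k l : ℂ, t = k • u + l • v) → f t = 0 := by
    rintro t ⟨k, l, rfl⟩
    simp [hu, hv]
  -- The nonzero complex functional `f` would vanish on the whole real tangent hyperplane.
  refine false_of_ker_le (l := fderiv ℝ Φ p)
    (σ := (LinearMap.toContinuousLinearMap f).restrictScalars ℝ) ?_ ?_
  · exact LinearMap.surjective hf0
  · intro t ht
    obtain ⟨x, rfl⟩ := h.tangent.self_of_nhds h.mem t ht
    change f (F.value p x) = 0
    simp [value, hz _ h₁, hz _ ha, hz _ hb, hz _ h₄, hz _ h₅]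

theorem IsTangentNear.isBiholomorphicNear_of_dependent (h : F.IsTangentNear M p Φ)
    (hF : F.IsRealization U) (hpU : p ∈ U) (hLevi : IsLeviNondegenerate M) {k l : ℂ}
    (ha : F.a p = k • F.e₁ p + l • F.b p) :
    IsBiholomorphicNear M (quadric 1) p ∨ IsBiholomorphicNear M (quadric (-1)) p := by
  have hind2 : ∀ x y : ℂ, x • F.e₁ p + y • F.b p = 0 → x = 0 ∧ y = 0 := by
    intro x y hxy
    have hy : y = 0 := by
      by_contra hy
      have hb : F.b p = (-x / y) • F.e₁ p := by
        have h3 : y • F.b p = -(x • F.e₁ p) := eq_neg_of_add_eq_zero_right hxy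
        have h4 : F.b p = y⁻¹ • (y • F.b p) := by rw [smul_smul, inv_mul_cancel₀ hy, one_smul]
        rw [h4, h3]
        module
      obtain ⟨n, hn⟩ : ∃ n : ℂ, F.b p = n • F.e₁ p := ⟨_, hb⟩
      obtain ⟨m, hm⟩ : ∃ m : ℂ, F.a p = m • F.e₁ p := ⟨k + l * n, by rw [ha, hn]; module⟩
      -- With $a=me_1$ and $b=ne_1$ at $p$, the relations $[e_1,a]=[e_1,b]=0$ make $Db(a)$ and
      -- $Da(b)$ both equal to $mn\,De_1(e_1)$; so $[a,b]=0$ at $p$, against $-2ie_1\neq0$.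
      have h1 := hF.lie_1a p hpU
      have h2 := hF.lie_1b p hpU
      have h3 := hF.lie_ab p hpU
      simp only [VectorField.lieBracket, hn, hm, map_smul, sub_eq_zero] at h1 h2 h3
      rw [h1, h2, smul_smul, smul_smul, mul_comm, sub_self] at h3
      have h4 := (smul_eq_zero.1 h3.symm).resolve_right h.e₁_ne
      simp at h4
    subst hy
    exact ⟨(smul_eq_zero.1 (by simpa using hxy)).resolve_right h.e₁_ne, rfl⟩
  by_cases h₄ : ∀ x y z : ℂ, x • F.e₁ p + y • F.b p + z • F.e₄ p = 0 → x = 0 ∧ y = 0 ∧ z = 0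
  · exact h.isBiholomorphicNear_of_transversal₄ hF hpU hLevi h₄ ha
  obtain ⟨k', l', hk⟩ := exists_eq_combination hind2 h₄
  by_cases h₅ : ∀ x y z : ℂ, x • F.e₁ p + y • F.b p + z • F.e₅ p = 0 → x = 0 ∧ y = 0 ∧ z = 0
  · obtain ⟨V, hV, τ, hτ, hd⟩ := hF.exists_function_of_transversal₅ hpU h₅ ha hk
    exact (h.false_of_real_derivs hLevi (c₄ := 0) (c₅ := 1) hV hτ (by simpa using hd)
      (.inr one_ne_zero)).elim
  · exact (h.not_mem_plane ⟨1, 0, by simp⟩ ⟨k, l, ha⟩ ⟨0, 1, by simp⟩ ⟨k', l', hk⟩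
      (exists_eq_combination hind2 h₅)).elim

theorem IsTangentNear.isBiholomorphicNear (h : F.IsTangentNear M p Φ)
    (hF : F.IsRealization U) (hpU : p ∈ U) (hLevi : IsLeviNondegenerate M) :
    IsBiholomorphicNear M (quadric 1) p ∨ IsBiholomorphicNear M (quadric (-1)) p := by
  by_cases hind : ∀ x y z : ℂ, x • F.e₁ p + y • F.a p + z • F.b p = 0 → x = 0 ∧ y = 0 ∧ z = 0
  · exact h.isBiholomorphicNear_of_free hF hpU hLevi hind
  have hsolve : ∀ {x y z : ℂ} {t u v : C3}, x • u + y • v + z • t = 0 → z ≠ 0 →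
      t = (-x / z) • u + (-y / z) • v := by
    intro x y z t u v h1 hz
    have h3 : z • t = -(x • u + y • v) := eq_neg_of_add_eq_zero_right h1
    have h4 : t = z⁻¹ • (z • t) := by rw [smul_smul, inv_mul_cancel₀ hz, one_smul]
    rw [h4, h3]
    module
  push Not at hind
  obtain ⟨x, y, z, h1, h2⟩ := hind
  -- If $a$ does not occur in the relation, then $b(p)$ is a multiple of $e_1(p)$, and the
  -- automorphism exchanging $a$ and $b$ reduces to the other case.
  by_cases hy : y = 0
  · have hz : z ≠ 0 := by
      rintro rfl
      refine h2 ?_ hy rfl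
      exact (smul_eq_zero.1 (by simpa [hy] using h1)).resolve_right h.e₁_ne
    have hb := hsolve h1 hz
    refine h.swap.isBiholomorphicNear_of_dependent hF.swap hpU hLevi (k := x / z) (l := -y / z) ?_
    simp only [FieldTuple.swap, Pi.smul_apply]
    rw [hb]
    module
  · exact h.isBiholomorphicNear_of_dependent hF hpU hLevi
      (hsolve (x := x) (y := z) (by rw [← h1]; abel) hy)

end FieldTuple

/-! ### From the real Lie algebra to the complexified fields. -/

namespace G537

/-- The element with the given coordinates in the basis `e₁, …, e₅`. -/
def ofCoords (x : Fin 5 → ℝ) : G537 := x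

/-- The basis vectors `e₁, …, e₅`. -/
def basisVec (i : Fin 5) : G537 := ofCoords (Pi.single i 1)

theorem basisVec_apply (i j : Fin 5) : basisVec i j = if j = i then 1 else 0 := by
  simp [basisVec, ofCoords, Pi.single_apply]

theorem eq_combination (x : G537) : x = x 0 • basisVec 0 + x 1 • basisVec 1 + x 2 • basisVec 2 +
    x 3 • basisVec 3 + x 4 • basisVec 4 := by
  apply ext_coords <;> simp [add_apply, smul_apply, basisVec_apply]

theorem lie_basisVec : ⁅basisVec 0, basisVec 1⁆ = 0 ∧ ⁅basisVec 0, basisVec 2⁆ = 0 ∧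
    ⁅basisVec 0, basisVec 3⁆ = (2 : ℝ) • basisVec 0 ∧ ⁅basisVec 0, basisVec 4⁆ = 0 ∧
    ⁅basisVec 1, basisVec 2⁆ = basisVec 0 ∧ ⁅basisVec 1, basisVec 3⁆ = basisVec 1 ∧
    ⁅basisVec 1, basisVec 4⁆ = -basisVec 2 ∧ ⁅basisVec 2, basisVec 3⁆ = basisVec 2 ∧
    ⁅basisVec 2, basisVec 4⁆ = basisVec 1 ∧ ⁅basisVec 3, basisVec 4⁆ = 0 := by
  have hneg : -basisVec 2 = (-1 : ℝ) • basisVec 2 := by simp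
  rw [hneg]
  refine ⟨?_, ?_, ?_, ?_, ?_, ?_, ?_, ?_, ?_, ?_⟩ <;> apply ext_coords <;>
    simp [lie_apply_zero, lie_apply_one, lie_apply_two, lie_apply_three, lie_apply_four, smul_apply,
      zero_apply, basisVec_apply]

/-- The fields `e₁, e₂ + i e₃, e₂ - i e₃, e₄, e₅` of a representation. -/
def fields (ρ : G537 →ₗ[ℝ] (C3 → C3)) : FieldTuple where
  e₁ := ρ (basisVec 0)
  a := ρ (basisVec 1) + Complex.I • ρ (basisVec 2)
  b := ρ (basisVec 1) + (-Complex.I) • ρ (basisVec 2)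
  e₄ := ρ (basisVec 3)
  e₅ := ρ (basisVec 4)

theorem fields_value (ρ : G537 →ₗ[ℝ] (C3 → C3)) (q : C3) (x : G537) :
    (fields ρ).value q x = ρ x q := by
  conv_rhs => rw [eq_combination x]
  simp only [map_add, map_smul, Pi.add_apply, Pi.smul_apply, FieldTuple.value, fields]
  ext i
  simp only [Pi.add_apply, Pi.smul_apply, smul_eq_mul, Complex.real_smul]
  linear_combination (-(x 2 : ℂ) * ρ (basisVec 2) q i) * Complex.I_mul_I

end G537

theorem IsHolomorphicRealization.fields {U : Set C3} {ρ : G537 →ₗ[ℝ] (C3 → C3)}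
    (h : IsHolomorphicRealization U ρ) : (G537.fields ρ).IsRealization U := by
  have D : ∀ i, DifferentiableOn ℂ (ρ (G537.basisVec i)) U := fun i => h.holomorphic _
  have d : ∀ i, ∀ q ∈ U, DifferentiableAt ℂ (ρ (G537.basisVec i)) q := fun i q hq =>
    (D i).differentiableAt (h.isOpen.mem_nhds hq)
  have ds : ∀ (c : ℂ) i, ∀ q ∈ U, DifferentiableAt ℂ (c • ρ (G537.basisVec i)) q :=
    fun c i q hq => (d i q hq).const_smul c
  have L : ∀ i j, ∀ q ∈ U, VectorField.lieBracket ℂ (ρ (G537.basisVec i)) (ρ (G537.basisVec j)) q =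
      ρ ⁅G537.basisVec i, G537.basisVec j⁆ q := fun i j q hq => (h.map_lie _ _ q hq).symm
  obtain ⟨h01, h02, h03, h04, h12, h13, h14, h23, h24, h34⟩ := G537.lie_basisVec
  have left : ∀ (c : ℂ) (j : Fin 5), ∀ q ∈ U, VectorField.lieBracket ℂ
      (ρ (G537.basisVec 1) + c • ρ (G537.basisVec 2)) (ρ (G537.basisVec j)) q =
      ρ ⁅G537.basisVec 1, G537.basisVec j⁆ q + c • ρ ⁅G537.basisVec 2, G537.basisVec j⁆ q := by
    intro c j q hq
    rw [VectorField.lieBracket_add_left (d 1 q hq) (ds c 2 q hq),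
      VectorField.lieBracket_const_smul_left (d 2 q hq), L 1 j q hq, L 2 j q hq]
  have right : ∀ (c : ℂ), ∀ q ∈ U, VectorField.lieBracket ℂ (ρ (G537.basisVec 0))
      (ρ (G537.basisVec 1) + c • ρ (G537.basisVec 2)) q = 0 := by
    intro c q hq
    rw [VectorField.lieBracket_add_right (d 1 q hq) (ds c 2 q hq),
      VectorField.lieBracket_const_smul_right (d 2 q hq), L 0 1 q hq, L 0 2 q hq, h01, h02]
    simp
  refine ⟨h.isOpen, D 0, (D 1).add ((D 2).const_smul _), (D 1).add ((D 2).const_smul _), D 3, D 4,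
    ?_, ?_, ?_, ?_, ?_, ?_, ?_, ?_, ?_, ?_⟩
  all_goals
    intro q hq
    simp only [G537.fields]
  · exact right _ q hq
  · exact right _ q hq
  · rw [L 0 3 q hq, h03]
    ext i
    simp
  · rw [L 0 4 q hq, h04]
    simp
  · rw [VectorField.lieBracket_add_right (d 1 q hq) (ds _ 2 q hq),
      VectorField.lieBracket_const_smul_right (d 2 q hq), left _ 1 q hq, left _ 2 q hq, lie_self,
      lie_self, h12, ← lie_skew, h12]
    ext i
    simp
    ring
  · rw [left _ 3 q hq, h13, h23]
    simp
  · rw [left _ 4 q hq, h14, h24]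
    ext i
    simp only [map_neg, Pi.neg_apply, Pi.add_apply, Pi.smul_apply, smul_eq_mul]
    linear_combination (-ρ (G537.basisVec 2) q i) * Complex.I_mul_I
  · rw [left _ 3 q hq, h13, h23]
    simp
  · rw [left _ 4 q hq, h14, h24]
    ext i
    simp only [map_neg, Pi.neg_apply, Pi.add_apply, Pi.smul_apply, smul_eq_mul]
    linear_combination (-ρ (G537.basisVec 2) q i) * Complex.I_mul_I
  · rw [L 3 4 q hq, h34]
    simp

theorem IsDefiningFunctionAt.eventually {M : Set C3} {p : C3} {Φ : C3 → ℝ}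
    (h : IsDefiningFunctionAt M p Φ) : ∀ᶠ q in 𝓝 p, IsDefiningFunctionAt M q Φ := by
  have hc : ContinuousAt (fderiv ℝ Φ) p := h.analyticAt.fderiv.continuousAt
  filter_upwards [h.analyticAt.eventually_analyticAt, hc.eventually_ne h.fderiv_ne_zero,
    h.mem_iff.eventually_nhds] with q h1 h2 h3 using ⟨h1, h2, h3⟩

theorem IsFiveDimensionalOrbit.isTangentNear {U M : Set C3} {ρ : G537 →ₗ[ℝ] (C3 → C3)}
    (h : IsFiveDimensionalOrbit U ρ M) {p : C3} {Φ : C3 → ℝ} (hp : p ∈ M)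
    (hΦ : IsDefiningFunctionAt M p Φ) : (G537.fields ρ).IsTangentNear M p Φ := by
  refine ⟨hp, hΦ, ?_, ?_⟩
  · filter_upwards [hΦ.eventually] with q hq hqM v hv
    have h1 : v ∈ LinearMap.range (evalAt ρ q) := by
      rw [h.range_eq_tangent q hqM Φ hq]
      exact hv
    obtain ⟨x, rfl⟩ := h1
    exact ⟨x, (G537.fields_value ρ q x).symm⟩
  -- The five-dimensional algebra is evaluated onto a five-dimensional tangent space, so evaluation
  -- at $p$ is injective and $e_1(p)\neq0$.
  · have hfin : Module.finrank ℝ G537 = 5 := Module.finrank_fin_fun ℝ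
    have : FiniteDimensional ℝ G537 := inferInstanceAs (FiniteDimensional ℝ (Fin 5 → ℝ))
    have hl : (fderiv ℝ Φ p : C3 →ₗ[ℝ] ℝ) ≠ 0 := fun h0 =>
      hΦ.fderiv_ne_zero (ContinuousLinearMap.coe_injective h0)
    have h6 : Module.finrank ℝ C3 = 6 := by simp [Module.finrank_pi_fintype, Complex.finrank_real_complex]
    have h1 := LinearMap.finrank_range_add_finrank_ker (fderiv ℝ Φ p : C3 →ₗ[ℝ] ℝ)
    rw [LinearMap.range_eq_top.2 (LinearMap.surjective hl), finrank_top, Module.finrank_self, h6]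
      at h1
    have h2 := LinearMap.finrank_range_add_finrank_ker (evalAt ρ p)
    rw [h.range_eq_tangent p hp Φ hΦ, hfin] at h2
    have h3 : LinearMap.ker (evalAt ρ p) = ⊥ := by
      rw [← Submodule.finrank_eq_zero (R := ℝ)]
      omega
    intro h0
    have h4 : G537.basisVec 0 ∈ LinearMap.ker (evalAt ρ p) := h0
    rw [h3, Submodule.mem_bot] at h4
    have h5 := G537.basisVec_apply 0 0
    rw [h4, G537.zero_apply] at h5
    simp at h5

end

theorem mainTheorem6 (U : Set C3) (ρ : G537 →ₗ[ℝ] (C3 → C3))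
    (hρ : IsHolomorphicRealization U ρ) (M : Set C3)
    (hM : IsFiveDimensionalOrbit U ρ M) (hLevi : IsLeviNondegenerate M) :
    IsSpherical M := by
  refine isSpherical_of_isBiholomorphicNear hM.isConnected fun p hp => ?_
  obtain ⟨Φ, hΦ⟩ := hM.hypersurface p hp
  exact (hM.isTangentNear hp hΦ).isBiholomorphicNear hρ.fields (hM.subset hp) hLevi
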